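/- **Conventions.** In a forcing notion the stronger condition is the larger one. $\nu\vartriangleleft\eta$ means that $\nu$ is a proper initial segment of $\eta$. Let $\mathbf H$ be a sequence of sets $\mathbf H(i)$, $i<\omega$, and let $\mathrm{Seq}=\bigcup_{n<\omega}\prod_{i<n}\mathbf H(i)$. *Quasi trees.* A quasi tree is a set $T$ of finite sequences with a $\trianglelefteq$-smallest element $\mathrm{root}(T)$. For $\eta\in T$, $\mathrm{suc}_T(\eta)$ is the set of immediate $\vartriangleleft$-successors of $\eta$ in $T$, $T^{[\eta]}=\{\nu\in T:\eta\trianglelefteq\nu\}$, $\max(T)$ is the set of $\vartriangleleft$-maximal elements, $\hat T=T\setminus\max(T)$, $\mathrm{dcl}(T)$ is the closure under initial segments, and $\lim(T)$ is the set of $\omega$-sequences $x$ with $x\restriction n\in T$ for infinitely many $n$. $T$ is well founded if $\lim(T)=\emptyset$. A front of $T$ is a $\vartriangleleft$-antichain $F\subseteq T$ such that each $x\in\lim(T)\cup\max(T)$ has an initial segment in $F$. *Tree-creating pairs.* A tree creature at $\eta\in\mathrm{Seq}$ is a triple $t=(\mathrm{nor}[t],\mathrm{val}[t],\mathrm{dis}[t])$,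 where $\mathrm{nor}[t]\ge 0$ is real, $\mathrm{val}[t]$ is a non-empty set of pairs $\langle\eta,\nu\rangle$ with $\eta\vartriangleleft\nu\in\mathrm{Seq}$, $\mathrm{pos}(t)=\mathrm{rng}(\mathrm{val}[t])$ is a $\vartriangleleft$-antichain, and $\mathrm{dis}[t]$ is an arbitrary parameter from a fixed set. A system is a family $\langle s_\nu:\nu\in\hat T\rangle$, $T\subseteq\mathrm{Seq}$ a well-founded quasi tree, where $s_\nu$ is a tree creature at $\nu$ with $\mathrm{pos}(s_\nu)=\mathrm{suc}_T(\nu)$. A tree-creating pair $(K,\Sigma)$ for $\mathbf H$ consists of a set $K$ of tree creatures and a function $\Sigma$ from the countable subsets of $K$ to the subsets of $K$ such that: $\Sigma(\emptyset)=\emptyset$; $t\in\Sigma(\{t\})$ for $t\in K$; if $s\in\Sigma(\mathcal S_s)$ for all $s\in\mathcal S$, then $\Sigma(\mathcal S)\subseteq\Sigma(\bigcup_{s\in\mathcal S}\mathcal S_s)$; if $\Sigma(\mathcal S)\ne\emptyset$, then $\mathcal S=\{s_\nu:\nu\in\hat T\}$ for some system; and each $t\in\Sigma(s_\nu:\nu\in\hat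 T)$ is a tree creature at $\mathrm{root}(T)$ with $\mathrm{pos}(t)\subseteq\max(T)$. The pair is * *bounded* if $\mathrm{nor}[t]\le\sup\{\mathrm{nor}[s_\nu]:(\exists\eta\in\mathrm{pos}(t))\ \nu\vartriangleleft\eta\}$ whenever $t\in\Sigma(s_\nu:\nu\in\hat T)$; * *$2$-big* if for each $t\in K$ with $\mathrm{nor}[t]>1$ and each $h:\mathrm{pos}(t)\to 2$ there is $s\in\Sigma(\{t\})$ with $\mathrm{nor}[s]\ge\mathrm{nor}[t]-1$ and $h$ constant on $\mathrm{pos}(s)$; * *t-omittory* if for each countable system $\langle s_\nu:\nu\in\hat T\rangle\subseteq K$ and each $\nu_0\in\hat T$ with $\mathrm{pos}(s_{\nu_0})\subseteq\max(T)$ there is $s\in\Sigma(s_\nu:\nu\in\hat T)$ with $\mathrm{nor}[s]\ge\mathrm{nor}[s_{\nu_0}]-1$ and $\mathrm{pos}(s)\subseteq\mathrm{pos}(s_{\nu_0})$. *The forcing notions.* For $e<4$, conditions of $\mathbb Q^{\rm tree}_e(K,\Sigma)$ are sequences $p=\langle t_\eta:\eta\in T\rangle$, where $T=T^p\subseteq\mathrm{Seq}$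 is a quasi tree with $\max(T)=\emptyset$, $t_\eta=t^p_\eta\in K$ is a tree creature at $\eta$ with $\mathrm{pos}(t_\eta)=\mathrm{suc}_T(\eta)$, and * $e=0$: $\limsup\langle\mathrm{nor}[t_{x\restriction k}]:x\restriction k\in T\rangle=\infty$ for each $x\in\lim(T)$; * $e=1$: $\langle\mathrm{nor}[t_{x\restriction k}]:x\restriction k\in T\rangle$ diverges to $\infty$ for each $x\in\lim(T)$; * $e=2$: for all $\eta\in T$, $n<\omega$ there is $\nu\in T$ with $\eta\vartriangleleft\nu$ and $\mathrm{nor}[t_\nu]\ge n$; * $e=3$: for all $\eta\in T$, $n<\omega$ there is $\nu\in T$ with $\eta\vartriangleleft\nu$ and $\mathrm{nor}[t_\rho]\ge n$ for all $\rho\in T$ with $\nu\vartriangleleft\rho$. The order: $p\le q$ iff $T^q\subseteq T^p$ and for each $\eta\in T^q$ there is a well-founded quasi tree $T_0\subseteq(T^p)^{[\eta]}$ with $t^q_\eta\in\Sigma(t^p_\nu:\nu\in\hat T_0)$. Put $p^{[\eta]}=\langle t^p_\nu:\nu\in(T^p)^{[\eta]}\rangle$. An $e$-thick antichain of $T^p$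 is a $\vartriangleleft$-antichain $A\subseteq T^p$ such that $A\cap\mathrm{dcl}(T^q)\neq\emptyset$ for all $q\ge p$ in $\mathbb Q^{\rm tree}_e(K,\Sigma)$. Let $F^0_n(p)$ be the set of $\eta\in T^p$ with $\mathrm{nor}[t^p_\eta]>n$ and $\mathrm{nor}[t^p_\nu]\le n$ for all $\nu\in T^p$, $\nu\vartriangleleft\eta$. For $e<3$: $p\le^e_0 q$ means $p\le q$ and $\mathrm{root}(T^p)=\mathrm{root}(T^q)$; $p\le^e_{n+1}q$ means $p\le^e_0q$, and $\nu\in T^q$, $t^q_\nu=t^p_\nu$ whenever $\nu\in T^p$, $\nu\trianglelefteq\eta\in F^0_n(p)$, and, if $e=1$, also $\{t^q_\eta:\eta\in T^q,\ \mathrm{nor}[t^q_\eta]\le n\}\subseteq\{t^p_\eta:\eta\in T^p\}$. **Theorem.** Let $(K,\Sigma)$ be a tree-creating pair for $\mathbf H$. 1. If $e<4$, $\Sigma$ is bounded in case $e=2$, and $\bigcup_{i<\omega}\mathbf H(i)$ is countable, then $\mathbb Q^{\rm tree}_e(K,\Sigma)$ is proper. 2. Let $e<3$, with $\Sigma$ bounded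 in case $e=2$, $p\in\mathbb Q^{\rm tree}_e(K,\Sigma)$, $n<\omega$, and let $\dot\tau_k$ ($k<\omega$) be $\mathbb Q^{\rm tree}_e(K,\Sigma)$-names for ordinals. Then there are a condition $q$ and $e$-thick antichains $A_k$ of $T^q$ such that for each $k$: $(\alpha)$ $p\le^e_nq$; $(\beta)$ for each $\eta\in A_k$ the condition $q^{[\eta]}$ decides the value of $\dot\tau_k$; $(\gamma)$ $(\forall\nu\in A_{k+1})(\exists\eta\in A_k)(\eta\vartriangleleft\nu)$. 3. For $e=3$, $p\in\mathbb Q^{\rm tree}_3(K,\Sigma)$ and names $\dot\tau_k$ for ordinals there are a condition $q\ge p$ and $3$-thick antichains $A_k$ of $T^q$ with $(\beta)$ and $(\gamma)$. 4. If either $e=0$ and $(K,\Sigma)$ is t-omittory, or $e=1$ and $(K,\Sigma)$ is $2$-big, then for $p$, $n$, $\dot\tau_k$ as in 2 there are a condition $q$ and fronts $F_k$ of $T^q$ such that $(\alpha)$, $(\beta)$, $(\gamma)$ hold with $F_k$ in place of $A_k$. -/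

import Mathlib

universe u

/-! ## Forcing notions, names for ordinals, properness

A forcing notion is a type with a relation `≤`; the stronger condition is the larger one. -/

namespace Forcing

/-- `P`-names: a name is a set of pairs `(name, condition)`. -/
inductive PName (P : Type u) : Type (u + 1)
  | mk (ι : Type u) (cond : ι → P) (name : ι → PName P) : PName P

/-- The canonical name of a ground model set: all pairs `(y̌, r)` with `y ∈ x` and `r ∈ P`. -/
def PName.check {P : Type u} : PSet.{u} → PName P
  | ⟨ι, x⟩ => PName.mk (ι × P) (fun i => i.2) (fun i => PName.check (x i.1))

variable {P : Type u} [LE P]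

/-- `ForcesEq σ τ p` is `p ⊩ σ = τ`. Every `q ≥ p` that puts an element into `σ` has an extension
which puts into `τ` an element that it forces to be equal to it, and conversely. -/
def ForcesEq : PName P → PName P → P → Prop
  | ⟨ι, c, x⟩, ⟨κ, d, y⟩ => fun p =>
    (∀ i : ι, ∀ q, p ≤ q → c i ≤ q →
      ∃ r, q ≤ r ∧ ∃ j : κ, d j ≤ r ∧ ForcesEq (x i) (y j) r) ∧
    (∀ j : κ, ∀ q, p ≤ q → d j ≤ q →
      ∃ r, q ≤ r ∧ ∃ i : ι, c i ≤ r ∧ ForcesEq (x i) (y j) r)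

/-- `p` decides the value of `τ`: for some ordinal `o`, `p ⊩ τ = ǒ`. -/
def Decides (p : P) (τ : PName P) : Prop :=
  ∃ o : Ordinal.{u}, ForcesEq τ (PName.check o.toPSet) p

/-- `τ` is a `P`-name for an ordinal: every condition forces `(∃ o ∈ Ord) τ = o`, where the
ordinals of the extension are those of the ground model. -/
def IsOrdinalName (τ : PName P) : Prop :=
  ∀ p : P, ∃ q, p ≤ q ∧ Decides q τ

def Compatible (p q : P) : Prop := ∃ r : P, p ≤ r ∧ q ≤ r

def IsDense (A : Set P) : Prop := ∀ p : P, ∃ d ∈ A, p ≤ d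

/-- Closed unbounded families of countable subsets of `X`. -/
structure IsClubCountable {X : Type u} (𝒞 : Set (Set X)) : Prop where
  countable : ∀ N ∈ 𝒞, N.Countable
  unbounded : ∀ s : Set X, s.Countable → ∃ N ∈ 𝒞, s ⊆ N
  closed : ∀ f : ℕ → Set X, Monotone f → (∀ n, f n ∈ 𝒞) → (⋃ n, f n) ∈ 𝒞

/-- `q` is `(N, P)`-generic, where `N` is a subset of a set `X` which contains, through `i`, all
conditions and all sets of conditions: for each dense set `A ∈ N` the set `A ∩ N` is predense
above `q`. -/
def IsGenericOver {X : Type u} (i : P ⊕ Set P → X) (N : Set X) (q : P) : Prop :=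
  ∀ A : Set P, IsDense A → i (Sum.inr A) ∈ N →
    ∀ r, q ≤ r → ∃ d ∈ A, i (Sum.inl d) ∈ N ∧ Compatible d r

variable (P) in
/-- `P` is proper: for each set `X ⊇ P ∪ 𝒫(P)` (for example `X = H(χ)`), for club many countable
`N ⊆ X`, each `p ∈ P ∩ N` has an `(N, P)`-generic extension. -/
def IsProper : Prop :=
  ∀ (X : Type u) (i : P ⊕ Set P → X), Function.Injective i →
    ∃ 𝒞 : Set (Set X), IsClubCountable 𝒞 ∧
      ∀ N ∈ 𝒞, ∀ p : P, i (Sum.inl p) ∈ N → ∃ q, p ≤ q ∧ IsGenericOver i N q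

end Forcing

/-! ## Quasi trees -/

namespace TreeCreature

open Forcing

variable {α D : Type u}

/-- `ν` is a proper initial segment of `η`. -/
def ProperPrefix (ν η : List α) : Prop := ν <+: η ∧ ν ≠ η

/-- The finite sequences in `⋃ₙ ∏_{i<n} H(i)`. -/
def Seqs (H : ℕ → Set α) : Set (List α) :=
  {η | ∀ (i : ℕ) (h : i < η.length), η[i] ∈ H i}

/-- The restriction `x ↾ n` of an infinite sequence. -/
def initSeg (x : ℕ → α) (n : ℕ) : List α := (List.range n).map x

/-- `r` is the smallest element (the root) of `T`. -/
def IsRoot (T : Set (List α)) (r : List α) : Prop := r ∈ T ∧ ∀ ν ∈ T, r <+: ν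

def IsQuasiTree (T : Set (List α)) : Prop := ∃ r, IsRoot T r

/-- The immediate successors of `η` in `T`. -/
def succs (T : Set (List α)) (η : List α) : Set (List α) :=
  {ν ∈ T | ProperPrefix η ν ∧ ¬ ∃ ρ ∈ T, ProperPrefix η ρ ∧ ProperPrefix ρ ν}

/-- `T^[η]`. -/
def above (T : Set (List α)) (η : List α) : Set (List α) := {ν ∈ T | η <+: ν}

def maxPts (T : Set (List α)) : Set (List α) := {ν ∈ T | ¬ ∃ ρ ∈ T, ProperPrefix ν ρ}

/-- `T̂ = T \ max(T)`. -/
def hat (T : Set (List α)) : Set (List α) := T \ maxPts T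

/-- The infinite branches through `T`. -/
def lim (T : Set (List α)) : Set (ℕ → α) :=
  {x | ∀ m : ℕ, ∃ n, m < n ∧ initSeg x n ∈ T}

def IsWellFoundedTree (T : Set (List α)) : Prop := lim T = ∅

/-- The downward closure. -/
def dcl (T : Set (List α)) : Set (List α) := {ν | ∃ η ∈ T, ν <+: η}

def IsPrefixAntichain (A : Set (List α)) : Prop :=
  ∀ η ∈ A, ∀ ν ∈ A, ¬ ProperPrefix η ν

/-- `F` is a front of the quasi tree `T`. -/
def IsFront (T F : Set (List α)) : Prop :=
  F ⊆ T ∧ IsPrefixAntichain F ∧ (∀ x ∈ lim T, ∃ n, initSeg x n ∈ F) ∧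
    ∀ η ∈ maxPts T, ∃ n, η.take n ∈ F

/-! ## Tree creatures and tree-creating pairs -/

/-- Weak creatures for `H`; `D` is the set of the possible values of the third coordinate. -/
structure WeakCreature (H : ℕ → Set α) (D : Type u) : Type u where
  nor : ℝ
  val : Set (List α × List α)
  dis : D
  nor_nonneg : 0 ≤ nor
  val_nonempty : val.Nonempty
  val_sub : ∀ w ∈ val, w.1 ∈ Seqs H ∧ w.2 ∈ Seqs H ∧ ProperPrefix w.1 w.2

variable {H : ℕ → Set α}

/-- `pos(t) = rng(val[t])`. -/
def WeakCreature.pos (t : WeakCreature H D) : Set (List α) := Prod.snd '' t.val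

/-- `t ∈ TCR_η[H]`. -/
def WeakCreature.IsTreeCreatureAt (t : WeakCreature H D) (η : List α) : Prop :=
  Prod.fst '' t.val = {η} ∧ IsPrefixAntichain t.pos

/-- `T` is a well founded quasi tree of sequences in `⋃ₙ ∏_{i<n} H(i)`, and `⟨s_ν : ν ∈ T̂⟩` is a
system of tree creatures with `s_ν ∈ TCR_ν[H]` and `rng(val[s_ν]) = suc_T(ν)`. -/
structure IsSystem (T : Set (List α)) (s : hat T → WeakCreature H D) : Prop where
  quasi : IsQuasiTree T
  wf : IsWellFoundedTree T
  seqs : T ⊆ Seqs H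
  creature : ∀ ν : hat T, (s ν).IsTreeCreatureAt ν
  pos_eq : ∀ ν : hat T, (s ν).pos = succs T ν

/-- Tree-creating pairs `(K, Σ)` for `H`. The operation `Σ` is defined on the countable subsets of
`K` only; it is extended here by the empty value to all other sets (see `countable`). -/
structure TreeCreatingPair (H : ℕ → Set α) (D : Type u) : Type u where
  K : Set (WeakCreature H D)
  Sig : Set (WeakCreature H D) → Set (WeakCreature H D)
  treeCreature : ∀ t ∈ K, ∃ η, t.IsTreeCreatureAt η
  sig_subset : ∀ S, Sig S ⊆ K
  countable : ∀ S, (Sig S).Nonempty → S ⊆ K ∧ S.Countable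
  trans : ∀ S ⊆ K, S.Countable → ∀ f : WeakCreature H D → Set (WeakCreature H D),
    (∀ s ∈ S, s ∈ Sig (f s)) → Sig S ⊆ Sig (⋃ s ∈ S, f s)
  self_mem : ∀ t ∈ K, t ∈ Sig {t}
  sig_empty : Sig ∅ = ∅
  system : ∀ S, (Sig S).Nonempty →
    ∃ (T : Set (List α)) (s : hat T → WeakCreature H D), IsSystem T s ∧ S = Set.range s
  result : ∀ (T : Set (List α)) (s : hat T → WeakCreature H D), IsSystem T s →
    ∀ t ∈ Sig (Set.range s), (∃ r, IsRoot T r ∧ t.IsTreeCreatureAt r) ∧ t.pos ⊆ maxPts T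

namespace TreeCreatingPair

/-- `Σ` is bounded: `nor[t] ≤ max {nor[s_ν] : (∃ η ∈ rng(val[t])) ν ◁ η}` for each
`t ∈ Σ(s_ν : ν ∈ T̂)`. As the set may be infinite, the maximum is read as the supremum. -/
def IsBounded (C : TreeCreatingPair H D) : Prop :=
  ∀ (T : Set (List α)) (s : hat T → WeakCreature H D), IsSystem T s →
    ∀ t ∈ C.Sig (Set.range s), ∀ c : ℝ,
      (∀ ν : hat T, (∃ η ∈ t.pos, ProperPrefix ν η) → (s ν).nor ≤ c) → t.nor ≤ c

/-- `(K, Σ)` is `k`-big. -/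
def IsBig (C : TreeCreatingPair H D) (k : ℕ) : Prop :=
  ∀ t ∈ C.K, 1 < t.nor → ∀ h : List α → Fin k,
    ∃ s ∈ C.Sig {t}, (∃ c, ∀ ν ∈ s.pos, h ν = c) ∧ t.nor - 1 ≤ s.nor

/-- `(K, Σ)` is t-omittory. (Only countable systems are in the domain of `Σ`.) -/
def IsTOmittory (C : TreeCreatingPair H D) : Prop :=
  ∀ (T : Set (List α)) (s : hat T → WeakCreature H D), IsSystem T s → (hat T).Countable →
    (∀ ν, s ν ∈ C.K) → ∀ ν₀ : hat T, (s ν₀).pos ⊆ maxPts T →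
      ∃ t ∈ C.Sig (Set.range s), (s ν₀).nor - 1 ≤ t.nor ∧ t.pos ⊆ (s ν₀).pos

end TreeCreatingPair

/-! ## The forcing notions `Q^tree_e(K, Σ)` -/

/-- The norm conditions `(c)_e`, `e < 4`, for a system `⟨t_η : η ∈ T⟩`. -/
def NormCond (T : Set (List α)) (t : T → WeakCreature H D) (e : Fin 4) : Prop :=
  match e with
  | 0 => ∀ x ∈ lim T, ∀ (M : ℝ) (m : ℕ), ∃ k, m ≤ k ∧ ∃ h : initSeg x k ∈ T, M < (t ⟨_, h⟩).nor
  | 1 => ∀ x ∈ lim T, ∀ M : ℝ, ∃ m : ℕ, ∀ k, m ≤ k → ∀ h : initSeg x k ∈ T, M < (t ⟨_, h⟩).nor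
  | 2 => ∀ η ∈ T, ∀ n : ℕ, ∃ ν : T, ProperPrefix η ν ∧ (n : ℝ) ≤ (t ν).nor
  | 3 => ∀ η ∈ T, ∀ n : ℕ, ∃ ν ∈ T, ProperPrefix η ν ∧
      ∀ ρ : T, ProperPrefix ν ρ → (n : ℝ) ≤ (t ρ).nor

/-- Conditions of `Q^tree_e(K, Σ)`: sequences `⟨t_η : η ∈ T⟩`. -/
structure QTree (C : TreeCreatingPair H D) (e : Fin 4) : Type u where
  T : Set (List α)
  t : T → WeakCreature H D
  seqs : T ⊆ Seqs H
  quasi : IsQuasiTree T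
  max_empty : maxPts T = ∅
  mem_K : ∀ η, t η ∈ C.K
  creature : ∀ η : T, (t η).IsTreeCreatureAt η
  pos_eq : ∀ η : T, (t η).pos = succs T η
  norm : NormCond T t e

variable {C : TreeCreatingPair H D} {e : Fin 4}

/-- The order of `Q^tree_e(K, Σ)`. -/
instance : LE (QTree C e) where
  le p q := q.T ⊆ p.T ∧ ∀ η : q.T, ∃ T₀ : Set (List α), IsQuasiTree T₀ ∧ IsWellFoundedTree T₀ ∧
    T₀ ⊆ above p.T η ∧ q.t η ∈ C.Sig {c | ∃ ν : p.T, ν.1 ∈ hat T₀ ∧ p.t ν = c}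

theorem initSeg_prefix_of_le (x : ℕ → α) {m n : ℕ} (h : m ≤ n) : initSeg x m <+: initSeg x n := by
  unfold initSeg
  obtain ⟨k, rfl⟩ := Nat.exists_eq_add_of_le h
  rw [List.range_add, List.map_append]
  exact List.prefix_append _ _

theorem succs_above {T : Set (List α)} {η ν : List α} (h : η <+: ν) :
    succs (above T η) ν = succs T ν := by
  ext ρ
  constructor
  · rintro ⟨h1, h2, h3⟩
    exact ⟨h1.1, h2, fun ⟨σ, hσ, a, b⟩ => h3 ⟨σ, ⟨hσ, h.trans a.1⟩, a, b⟩⟩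
  · rintro ⟨h1, h2, h3⟩
    exact ⟨⟨h1, h.trans h2.1⟩, h2, fun ⟨σ, hσ, a, b⟩ => h3 ⟨σ, hσ.1, a, b⟩⟩

theorem prefix_of_mem_lim_above {T : Set (List α)} {η : List α} {x : ℕ → α}
    (hx : x ∈ lim (above T η)) : ∃ m, ∀ k, m ≤ k → η <+: initSeg x k := by
  obtain ⟨n, -, hn⟩ := hx 0
  exact ⟨n, fun k hk => hn.2.trans (initSeg_prefix_of_le x hk)⟩

theorem lim_above_subset {T : Set (List α)} {η : List α} : lim (above T η) ⊆ lim T :=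
  fun _ hx m => (hx m).imp fun _ h => ⟨h.1, h.2.1⟩

theorem normCond_above {T : Set (List α)} {t : T → WeakCreature H D} (h : NormCond T t e)
    (η : List α) : NormCond (above T η) (fun ν => t ⟨ν.1, ν.2.1⟩) e := by
  fin_cases e
  · intro x hx M m
    obtain ⟨m', hm'⟩ := prefix_of_mem_lim_above hx
    obtain ⟨k, hk, hT, hM⟩ := h x (lim_above_subset hx) M (max m m')
    exact ⟨k, (le_max_left _ _).trans hk, ⟨hT, hm' k ((le_max_right _ _).trans hk)⟩, hM⟩
  · intro x hx M
    obtain ⟨m, hm⟩ := h x (lim_above_subset hx) M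
    exact ⟨m, fun k hk hT => hm k hk hT.1⟩
  · intro ν hν n
    obtain ⟨ρ, hρ, hn⟩ := h ν hν.1 n
    exact ⟨⟨ρ.1, ρ.2, hν.2.trans hρ.1⟩, hρ, hn⟩
  · intro ν hν n
    obtain ⟨ρ, hρ, h1, h2⟩ := h ν hν.1 n
    exact ⟨ρ, ⟨hρ, hν.2.trans h1.1⟩, h1, fun σ hσ => h2 ⟨σ.1, σ.2.1⟩ hσ⟩

namespace QTree

/-- `p^[η] = ⟨t^p_ν : ν ∈ (T^p)^[η]⟩`. -/
def restr (p : QTree C e) (η : List α) (hη : η ∈ p.T) : QTree C e where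
  T := above p.T η
  t := fun ν => p.t ⟨ν.1, ν.2.1⟩
  seqs := fun _ h => p.seqs h.1
  quasi := ⟨η, ⟨hη, List.prefix_rfl⟩, fun _ h => h.2⟩
  max_empty := by
    refine Set.eq_empty_of_forall_notMem fun ν hν => ?_
    have h : ν ∈ maxPts p.T :=
      ⟨hν.1.1, fun ⟨ρ, hρ, h⟩ => hν.2 ⟨ρ, ⟨hρ, hν.1.2.trans h.1⟩, h⟩⟩
    rw [p.max_empty] at h
    exact h
  mem_K := fun _ => p.mem_K _
  creature := fun _ => p.creature _
  pos_eq := fun ν => (p.pos_eq _).trans (succs_above ν.2.2).symm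
  norm := normCond_above p.norm η

/-- `F⁰_n(p)`: the minimal nodes among those of norm greater than `n`. -/
def firstNodes (p : QTree C e) (n : ℕ) : Set (List α) :=
  {η | ∃ h : η ∈ p.T, (n : ℝ) < (p.t ⟨η, h⟩).nor ∧
    ∀ ν : p.T, ProperPrefix ν η → (p.t ν).nor ≤ n}

/-- The relations `p ≤ᵉ_n q` (used for `e < 3`). -/
def LEn (n : ℕ) (p q : QTree C e) : Prop :=
  (p ≤ q ∧ ∃ r, IsRoot p.T r ∧ IsRoot q.T r) ∧
  match n with
  | 0 => True
  | m + 1 =>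
    (∀ η ∈ p.firstNodes m, ∀ ν : p.T, ν.1 <+: η → ∃ h : ν.1 ∈ q.T, q.t ⟨ν.1, h⟩ = p.t ν) ∧
    (e = 1 → {c | (∃ η, q.t η = c) ∧ c.nor ≤ m} ⊆ Set.range p.t)

/-- `A` is an `e`-thick antichain of `T^p`. -/
def IsThickAntichain (p : QTree C e) (A : Set (List α)) : Prop :=
  A ⊆ p.T ∧ IsPrefixAntichain A ∧ ∀ q : QTree C e, p ≤ q → (A ∩ dcl q.T).Nonempty

/-- The names `τ_k` are decided along the sets `A_k ⊆ T^q`: `q^[η]` decides `τ_k` for `η ∈ A_k`,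
and each element of `A_{k+1}` properly extends an element of `A_k`. -/
def DecidesAlong (q : QTree C e) (τ : ℕ → PName (QTree C e)) (A : ℕ → Set (List α)) : Prop :=
  ∀ k, (∀ (η : List α) (h : η ∈ q.T), η ∈ A k → Decides (q.restr η h) (τ k)) ∧
    ∀ ν ∈ A (k + 1), ∃ η ∈ A k, ProperPrefix η ν

end QTree

end TreeCreature

open Forcing TreeCreature

/-! ### Persistence of decisions under stronger conditions -/

namespace Forcing

variable {P : Type u} [LE P]

/-! All four parts come from one fusion argument. A condition is pruned not along the levels of its
tree but along a sequence of antichains, which are required only to meet certain sets of nodes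
called tests. For thick antichains, the tests of `p` are the trees of the conditions stronger than
`p`; for fronts, they are the infinite subsets of branches of `p`. The two kinds of antichain can
then be treated together (`IsTestFamily`).

Suppose an antichain `A k` of `p k` meets all tests. Consider the nodes `μ` properly above some `ν`
in `A k` for which there is a condition with root `μ`, stronger than the cone of `p k` at `ν`,
belonging to a prescribed class and of large norm. The minimal such nodes form an antichain `A
(k+1)`. If such nodes exist in every test of every cone in question, `A (k+1)` again meets all
tests. Gluing the chosen conditions in above `A (k+1)` gives `p (k+1)` (`exists_fusionStep`,
`exists_glue`). A node of `p k` that is not above `A (k+1)` is never changed again, and the limit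
consists of these settled nodes (`IsFusion.exists_limit`). The norms forced at stage `k` are at
least `k + n`: at the points of `A (k+1)` for `e = 0, 2`, at all new creatures for `e = 1`, and
everywhere above `A (k+1)` for `e = 3`. This is what the norm condition of the limit needs. To
respect `≤ᵉ_{m+1}`, the fusion starts from the antichain `F⁰_m(p)`, which meets the tests because
norms are unbounded along branches or, for `e = 2`, because `Σ` is bounded.

For thick antichains the required density is genericity: inside a test, which is itself a condition,
one passes to a stronger condition deciding the name and then to a cone of large norm. For
properness the prescribed class consists of the conditions in `N` that extend a member of the `k`-th
dense set in `N`. As there are only countably many possible roots `μ`, a club of models `N` is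
closed under choosing such conditions with a given root.

For fronts a test is only a piece of a branch, so the name has to be decided along all branches
without moving the root. In the omittory case, a single creature jumps from the root to the
possibilities of a node whose cone already decides. In the 2-big case, if some nodes were bad,
bigness would yield a condition made of bad nodes only, whereas a stronger condition deciding the
name has good nodes. -/

theorem ForcesEq.mono (htrans : ∀ a b c : P, a ≤ b → b ≤ c → a ≤ c) {p q : P} (hpq : p ≤ q) :
    ∀ {σ τ : PName P}, ForcesEq σ τ p → ForcesEq σ τ q
  | ⟨_, _, _⟩, ⟨_, _, _⟩, h => by
    rw [ForcesEq] at h ⊢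
    exact ⟨fun i r hr => h.1 i r (htrans _ _ _ hpq hr), fun j r hr => h.2 j r (htrans _ _ _ hpq hr)⟩

theorem Decides.mono (htrans : ∀ a b c : P, a ≤ b → b ≤ c → a ≤ c) {p q : P} (hpq : p ≤ q)
    {τ : PName P} (h : Decides p τ) : Decides q τ :=
  h.imp fun _ ho => ho.mono htrans hpq

end Forcing

namespace TreeCreature

open Forcing

variable {α D : Type u}

/-! ### Proper initial segments -/

theorem properPrefix_iff {ν η : List α} :
    ProperPrefix ν η ↔ ν <+: η ∧ ν.length < η.length := by
  constructor
  · rintro ⟨h, hne⟩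
    exact ⟨h, lt_of_le_of_ne h.length_le fun h' => hne (h.eq_of_length h')⟩
  · rintro ⟨h, hl⟩
    exact ⟨h, fun h' => by simp [h'] at hl⟩

theorem ProperPrefix.length_lt {ν η : List α} (h : ProperPrefix ν η) : ν.length < η.length :=
  (properPrefix_iff.1 h).2

theorem ProperPrefix.trans_isPrefix {ν η ρ : List α} (h : ProperPrefix ν η) (h' : η <+: ρ) :
    ProperPrefix ν ρ :=
  properPrefix_iff.2 ⟨h.1.trans h', h.length_lt.trans_le h'.length_le⟩

theorem _root_.List.IsPrefix.trans_properPrefix {ν η ρ : List α} (h : ν <+: η)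
    (h' : ProperPrefix η ρ) : ProperPrefix ν ρ :=
  properPrefix_iff.2 ⟨h.trans h'.1, h.length_le.trans_lt h'.length_lt⟩

theorem ProperPrefix.not_isPrefix {ν η : List α} (h : ProperPrefix ν η) : ¬ η <+: ν :=
  fun h' => absurd h.length_lt (not_lt.2 h'.length_le)

theorem prefix_antisymm {ν η : List α} (h : ν <+: η) (h' : η <+: ν) : ν = η :=
  h.eq_of_length (le_antisymm h.length_le h'.length_le)

theorem prefix_total {ν η ρ : List α} (h : ν <+: ρ) (h' : η <+: ρ) : ν <+: η ∨ η <+: ν :=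
  (le_total ν.length η.length).imp (List.prefix_of_prefix_length_le h h')
    (List.prefix_of_prefix_length_le h' h)

theorem prefix_or_properPrefix {ν η ρ : List α} (h : ν <+: ρ) (h' : η <+: ρ) :
    ν <+: η ∨ ProperPrefix η ν := by
  by_cases hνη : ν <+: η
  · exact Or.inl hνη
  · have h2 := (prefix_total h h').resolve_left hνη
    exact Or.inr ⟨h2, fun h3 => hνη (h3 ▸ List.prefix_rfl)⟩

theorem IsPrefixAntichain.eq {A : Set (List α)} (hA : IsPrefixAntichain A) {ν η ρ : List α}
    (hν : ν ∈ A) (hη : η ∈ A) (h : ν <+: ρ) (h' : η <+: ρ) : ν = η := by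
  rcases prefix_or_properPrefix h h' with h1 | h1
  · by_contra hne
    exact hA ν hν η hη ⟨h1, hne⟩
  · exact (hA η hη ν hν h1).elim

/-- The minimal elements of a set of sequences. -/
def minPts (Z : Set (List α)) : Set (List α) := {μ ∈ Z | ∀ ρ ∈ Z, ¬ ProperPrefix ρ μ}

theorem minPts_subset (Z : Set (List α)) : minPts Z ⊆ Z := fun _ h => h.1

theorem isPrefixAntichain_minPts (Z : Set (List α)) : IsPrefixAntichain (minPts Z) :=
  fun η hη _ hν h => hν.2 η hη.1 h

theorem exists_minPts_isPrefix {Z : Set (List α)} {μ : List α} (hμ : μ ∈ Z) :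
    ∃ ν ∈ minPts Z, ν <+: μ := by
  induction hn : μ.length using Nat.strong_induction_on generalizing μ with
  | _ n ih =>
    by_cases h : ∃ ρ ∈ Z, ProperPrefix ρ μ
    · obtain ⟨ρ, hρ, hρμ⟩ := h
      obtain ⟨ν, hν, h⟩ := ih _ (hn ▸ hρμ.length_lt) hρ rfl
      exact ⟨ν, hν, h.trans hρμ.1⟩
    · exact ⟨μ, ⟨hμ, fun ρ hρ h' => h ⟨ρ, hρ, h'⟩⟩, List.prefix_rfl⟩

theorem isPrefixAntichain_singleton (η : List α) : IsPrefixAntichain {η} := by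
  rintro _ rfl _ rfl h
  exact h.2 rfl

/-! ### Branches and successors -/

@[simp] theorem length_initSeg (x : ℕ → α) (n : ℕ) : (initSeg x n).length = n := by
  simp [initSeg]

theorem eq_initSeg_of_isPrefix {x : ℕ → α} {n : ℕ} {ν : List α} (h : ν <+: initSeg x n) :
    ν = initSeg x ν.length := by
  have hl : ν.length ≤ n := by simpa using h.length_le
  have h2 := initSeg_prefix_of_le x hl
  exact prefix_antisymm (List.prefix_of_prefix_length_le h h2 (by simp))
    (List.prefix_of_prefix_length_le h2 h (by simp))

theorem initSeg_prefix_iff {x : ℕ → α} {m n : ℕ} : initSeg x m <+: initSeg x n ↔ m ≤ n :=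
  ⟨fun h => by simpa using h.length_le, initSeg_prefix_of_le x⟩

theorem initSeg_properPrefix_iff {x : ℕ → α} {m n : ℕ} :
    ProperPrefix (initSeg x m) (initSeg x n) ↔ m < n := by
  rw [properPrefix_iff, initSeg_prefix_iff]
  simpa using fun h : m < n => h.le

theorem lim_mono {S T : Set (List α)} (h : S ⊆ T) : lim S ⊆ lim T :=
  fun _ hx m => (hx m).imp fun _ hn => ⟨hn.1, h hn.2⟩

/-- An infinite `◁`-increasing chain has a limit. -/
theorem exists_branch_of_chain (f : ℕ → List α) (hf : ∀ n, ProperPrefix (f n) (f (n + 1))) :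
    ∃ x : ℕ → α, ∀ n, f n = initSeg x (f n).length := by
  have hlen : ∀ n, n ≤ (f n).length := by
    intro n
    induction n with
    | zero => exact Nat.zero_le _
    | succ n ih => exact Nat.succ_le_of_lt (ih.trans_lt (hf n).length_lt)
  have hpre : ∀ m n, m ≤ n → f m <+: f n := by
    intro m n h
    induction n, h using Nat.le_induction with
    | base => exact List.prefix_rfl
    | succ n _ ih => exact ih.trans (hf n).1
  -- The `i`-th value is read off `f (i + 1)`, which is long enough because lengths grow by at least
  -- one at each step.
  refine ⟨fun i => (f (i + 1))[i]'(hlen (i + 1)), fun n => ?_⟩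
  apply List.ext_getElem
  · simp
  · intro i h1 h2
    simp only [initSeg, List.getElem_map, List.getElem_range]
    rcases le_total n (i + 1) with h | h
    · exact (hpre _ _ h).getElem h1
    · exact ((hpre _ _ h).getElem (hlen (i + 1))).symm

theorem exists_succ_isPrefix {T : Set (List α)} {ν ρ : List α} (hρ : ρ ∈ T)
    (h : ProperPrefix ν ρ) : ∃ μ ∈ succs T ν, μ <+: ρ := by
  obtain ⟨μ, hμ, hle⟩ := exists_minPts_isPrefix (Z := {σ ∈ T | ProperPrefix ν σ}) ⟨hρ, h⟩
  exact ⟨μ, ⟨hμ.1.1, hμ.1.2, fun ⟨σ, hσ, h1, h2⟩ => hμ.2 σ ⟨hσ, h1⟩ h2⟩, hle⟩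

/-- Without an immediate predecessor of `ν`, one could climb from the root by immediate successors
below `ν` forever, through proper initial segments of `ν` of unbounded length. -/
theorem exists_mem_succs {T : Set (List α)} {r ν : List α} (hr : IsRoot T r) (hν : ν ∈ T)
    (hne : ν ≠ r) : ∃ σ ∈ T, ν ∈ succs T σ := by
  by_contra hcon
  have key : ∀ n, ∃ σ ∈ T, ProperPrefix σ ν ∧ n ≤ σ.length := by
    intro n
    induction n with
    | zero => exact ⟨r, hr.1, ⟨hr.2 ν hν, hne.symm⟩, Nat.zero_le _⟩
    | succ n ih =>
      obtain ⟨σ, hσ, hlt, hle⟩ := ih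
      obtain ⟨μ, hμ, hμν⟩ := exists_succ_isPrefix hν hlt
      refine ⟨μ, hμ.1, ⟨hμν, ?_⟩, hle.trans_lt hμ.2.1.length_lt⟩
      rintro rfl
      exact hcon ⟨σ, hσ, hμ⟩
  obtain ⟨σ, -, h1, h2⟩ := key ν.length
  exact absurd h1.length_lt (not_lt.2 h2)

theorem IsRoot.unique {T : Set (List α)} {r r' : List α} (h : IsRoot T r) (h' : IsRoot T r') :
    r = r' := prefix_antisymm (h.2 _ h'.1) (h'.2 _ h.1)

theorem IsRoot.mem_hat {T : Set (List α)} {r ν : List α} (h : IsRoot T r) (hν : ν ∈ hat T) :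
    r ∈ hat T := by
  refine ⟨h.1, fun hr => ?_⟩
  by_cases hne : r = ν
  · exact hν.2 (hne ▸ hr)
  · exact hr.2 ⟨ν, hν.1, h.2 _ hν.1, hne⟩

/-! ### Creatures -/

variable {H : ℕ → Set α}

theorem WeakCreature.IsTreeCreatureAt.unique {t : WeakCreature H D} {η ν : List α}
    (h : t.IsTreeCreatureAt η) (h' : t.IsTreeCreatureAt ν) : η = ν :=
  Set.singleton_eq_singleton_iff.1 (h.1.symm.trans h'.1)

theorem WeakCreature.pos_nonempty (t : WeakCreature H D) : t.pos.Nonempty :=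
  t.val_nonempty.image _

theorem WeakCreature.IsTreeCreatureAt.properPrefix {t : WeakCreature H D} {η ν : List α}
    (h : t.IsTreeCreatureAt η) (hν : ν ∈ t.pos) : ProperPrefix η ν := by
  obtain ⟨w, hw, rfl⟩ := hν
  have : w.1 ∈ ({η} : Set (List α)) := h.1 ▸ Set.mem_image_of_mem _ hw
  rw [Set.mem_singleton_iff] at this
  exact this ▸ (t.val_sub w hw).2.2

theorem WeakCreature.IsTreeCreatureAt.mem_seqs {t : WeakCreature H D} {η : List α}
    (h : t.IsTreeCreatureAt η) : η ∈ Seqs H := by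
  have h1 : η ∈ Prod.fst '' t.val := h.1 ▸ rfl
  obtain ⟨w, hw, rfl⟩ := h1
  exact (t.val_sub w hw).1

/-- The norm conditions for families of creatures indexed by all finite sequences. -/
def TotalNormCond (T : Set (List α)) (c : List α → WeakCreature H D) (e : Fin 4) : Prop :=
  match e with
  | 0 => ∀ x ∈ lim T, ∀ (M : ℝ) (m : ℕ), ∃ k, m ≤ k ∧ initSeg x k ∈ T ∧ M < (c (initSeg x k)).nor
  | 1 => ∀ x ∈ lim T, ∀ M : ℝ, ∃ m : ℕ, ∀ k, m ≤ k → initSeg x k ∈ T → M < (c (initSeg x k)).nor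
  | 2 => ∀ η ∈ T, ∀ n : ℕ, ∃ ν ∈ T, ProperPrefix η ν ∧ (n : ℝ) ≤ (c ν).nor
  | 3 => ∀ η ∈ T, ∀ n : ℕ, ∃ ν ∈ T, ProperPrefix η ν ∧
      ∀ ρ ∈ T, ProperPrefix ν ρ → (n : ℝ) ≤ (c ρ).nor

theorem normCond_iff {T : Set (List α)} {t : T → WeakCreature H D} {c : List α → WeakCreature H D}
    (h : ∀ ν : T, t ν = c ν) (e : Fin 4) : NormCond T t e ↔ TotalNormCond T c e := by
  obtain rfl : t = fun ν : T => c ν := funext h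
  fin_cases e <;> simp [NormCond, TotalNormCond, and_left_comm]

end TreeCreature

/-! ### Conditions as families of creatures indexed by all finite sequences -/

namespace TreeCreature

open Forcing

variable {α D : Type u} {H : ℕ → Set α} {C : TreeCreatingPair H D} {e : Fin 4}

namespace QTree

open Classical in
/-- The creature of `p` at `ν`; the value is arbitrary for `ν ∉ T^p`. -/
noncomputable def cr (p : QTree C e) (ν : List α) : WeakCreature H D :=
  if h : ν ∈ p.T then p.t ⟨ν, h⟩ else p.t ⟨p.quasi.choose, p.quasi.choose_spec.1⟩

theorem cr_coe (p : QTree C e) (ν : p.T) : p.cr ν = p.t ν := by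
  simp [cr]

theorem cr_of_mem (p : QTree C e) {ν : List α} (h : ν ∈ p.T) : p.cr ν = p.t ⟨ν, h⟩ :=
  p.cr_coe ⟨ν, h⟩

theorem cr_mem_K (p : QTree C e) (ν : List α) : p.cr ν ∈ C.K := by
  unfold cr
  split_ifs <;> exact p.mem_K _

theorem cr_creature (p : QTree C e) {ν : List α} (h : ν ∈ p.T) :
    (p.cr ν).IsTreeCreatureAt ν := by
  rw [p.cr_of_mem h]
  exact p.creature ⟨ν, h⟩

theorem cr_pos (p : QTree C e) {ν : List α} (h : ν ∈ p.T) : (p.cr ν).pos = succs p.T ν := by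
  rw [p.cr_of_mem h]
  exact p.pos_eq ⟨ν, h⟩

theorem pos_cr_subset (p : QTree C e) {ν : List α} (h : ν ∈ p.T) : (p.cr ν).pos ⊆ p.T :=
  fun _ hμ => (p.cr_pos h ▸ hμ : _ ∈ succs p.T ν).1

theorem exists_pos_isPrefix (p : QTree C e) {ν ρ : List α} (hν : ν ∈ p.T) (hρ : ρ ∈ p.T)
    (h : ProperPrefix ν ρ) : ∃ μ ∈ (p.cr ν).pos, μ <+: ρ := by
  rw [p.cr_pos hν]
  exact exists_succ_isPrefix hρ h

theorem totalNormCond (p : QTree C e) : TotalNormCond p.T p.cr e :=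
  (normCond_iff (fun ν => (p.cr_coe ν).symm) e).1 p.norm

theorem ext_cr {p q : QTree C e} (hT : p.T = q.T) (hcr : ∀ ν ∈ p.T, p.cr ν = q.cr ν) : p = q := by
  have ht : ∀ ν (h : ν ∈ p.T) (h' : ν ∈ q.T), p.t ⟨ν, h⟩ = q.t ⟨ν, h'⟩ := fun ν h h' => by
    rw [← p.cr_of_mem h, ← q.cr_of_mem h', hcr ν h]
  cases p
  cases q
  dsimp only at hT ht
  subst hT
  congr
  exact funext fun ν => ht ν.1 ν.2 ν.2

theorem exists_properPrefix (p : QTree C e) {ν : List α} (h : ν ∈ p.T) :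
    ∃ μ ∈ p.T, ProperPrefix ν μ := by
  obtain ⟨μ, hμ⟩ := (p.cr ν).pos_nonempty
  exact ⟨μ, p.pos_cr_subset h hμ, (p.cr_creature h).properPrefix hμ⟩

/-- A condition is given by a set with a root and by creatures whose possibilities lie in the set
and separate the points of the set. -/
theorem exists_of_pass {T : Set (List α)} {c : List α → WeakCreature H D} {r : List α}
    (hr : IsRoot T r) (hK : ∀ ν ∈ T, c ν ∈ C.K) (hc : ∀ ν ∈ T, (c ν).IsTreeCreatureAt ν)
    (hpos : ∀ ν ∈ T, (c ν).pos ⊆ T)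
    (hpass : ∀ ν ∈ T, ∀ ρ ∈ T, ProperPrefix ν ρ → ∃ μ ∈ (c ν).pos, μ <+: ρ)
    (hnorm : TotalNormCond T c e) :
    ∃ q : QTree C e, q.T = T ∧ ∀ ν ∈ T, q.cr ν = c ν := by
  have hs : ∀ ν ∈ T, (c ν).pos = succs T ν := by
    intro ν hν
    ext μ
    constructor
    · intro hμ
      refine ⟨hpos ν hν hμ, (hc ν hν).properPrefix hμ, ?_⟩
      rintro ⟨ρ, hρ, h1, h2⟩
      obtain ⟨σ, hσ, hσρ⟩ := hpass ν hν ρ hρ h1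
      exact (hc ν hν).2 σ hσ μ hμ (hσρ.trans_properPrefix h2)
    · rintro ⟨hμ, hlt, hmin⟩
      obtain ⟨σ, hσ, hσμ⟩ := hpass ν hν μ hμ hlt
      by_cases heq : σ = μ
      · exact heq ▸ hσ
      · exact (hmin ⟨σ, hpos ν hν hσ, (hc ν hν).properPrefix hσ, hσμ, heq⟩).elim
  refine ⟨⟨T, fun ν => c ν, fun ν hν => (hc ν hν).mem_seqs, ⟨r, hr⟩, ?_, fun ν => hK ν ν.2,
    fun ν => hc ν ν.2, fun ν => hs ν ν.2, (normCond_iff (fun _ => rfl) e).2 hnorm⟩, rfl, ?_⟩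
  · refine Set.eq_empty_of_forall_notMem fun ν hν => ?_
    obtain ⟨μ, hμ⟩ := (c ν).pos_nonempty
    exact hν.2 ⟨μ, hpos ν hν.1 hμ, (hc ν hν.1).properPrefix hμ⟩
  · intro ν hν
    exact cr_of_mem _ hν

/-! ### The order -/

/-- The creatures that `Σ` yields from the creatures of `p`. -/
def gens (p : QTree C e) : Set (WeakCreature H D) := {c | ∃ A ⊆ p.T, c ∈ C.Sig (p.cr '' A)}

theorem gens_subset_K (p : QTree C e) : p.gens ⊆ C.K := by
  rintro c ⟨A, -, hc⟩
  exact C.sig_subset _ hc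

theorem cr_mem_gens (p : QTree C e) {ν : List α} (h : ν ∈ p.T) : p.cr ν ∈ p.gens :=
  ⟨{ν}, by simpa using h, by simpa using C.self_mem _ (p.cr_mem_K ν)⟩

theorem sig_subset_gens (p : QTree C e) {ν : List α} (h : ν ∈ p.T) :
    C.Sig {p.cr ν} ⊆ p.gens := fun c hc => ⟨{ν}, by simpa using h, by simpa using hc⟩

/-- A tree creature determines the node it sits at, so the system provided by the axiom `system`
must carry the creature of `p` at each of its nodes. Every node of the system other than the root is
a possibility of such a creature and hence belongs to `p`. -/
theorem exists_system_of_mem_sig (p : QTree C e) {c : WeakCreature H D} {A : Set (List α)}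
    (hA : A ⊆ p.T) (hc : c ∈ C.Sig (p.cr '' A)) :
    ∃ (T : Set (List α)) (s : hat T → WeakCreature H D), IsSystem T s ∧ T ⊆ p.T ∧
      c ∈ C.Sig (Set.range s) ∧ (∀ ν : hat T, s ν = p.cr ν) ∧ ∃ r ∈ A, IsRoot T r := by
  obtain ⟨T, s, hs, hAs⟩ := C.system _ ⟨c, hc⟩
  have h1 : ∀ ν : hat T, ν.1 ∈ A ∧ s ν = p.cr ν := by
    intro ν
    obtain ⟨μ, hμ, heq⟩ : s ν ∈ p.cr '' A := hAs ▸ Set.mem_range_self ν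
    obtain rfl : μ = ν.1 := (p.cr_creature (hA hμ)).unique (heq ▸ hs.creature ν)
    exact ⟨hμ, heq.symm⟩
  -- A system with no creatures would put `c` into `Σ(∅)`, which is empty.
  have hne : (hat T).Nonempty := by
    by_contra h
    have : Set.range s = ∅ := by
      rw [Set.range_eq_empty_iff]
      exact ⟨fun ν => h ⟨ν.1, ν.2⟩⟩
    rw [hAs, this, C.sig_empty] at hc
    exact hc
  obtain ⟨r, hr⟩ := hs.quasi
  have hrh := hr.mem_hat hne.choose_spec
  refine ⟨T, s, hs, fun ν hν => ?_, hAs ▸ hc, fun ν => (h1 ν).2, r,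
    (h1 ⟨r, hrh⟩).1, hr⟩
  by_cases hνr : ν = r
  · exact hνr ▸ hA (h1 ⟨r, hrh⟩).1
  · obtain ⟨σ, hσ, hσν⟩ := exists_mem_succs hr hν hνr
    have hσh : σ ∈ hat T := ⟨hσ, fun h => h.2 ⟨ν, hν, hσν.2.1⟩⟩
    rw [← hs.pos_eq ⟨σ, hσh⟩, (h1 _).2] at hσν
    exact p.pos_cr_subset (hA (h1 ⟨σ, hσh⟩).1) hσν

theorem exists_system_of_mem_gens (p : QTree C e) {c : WeakCreature H D} (hc : c ∈ p.gens) :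
    ∃ (T : Set (List α)) (s : hat T → WeakCreature H D), IsSystem T s ∧ T ⊆ p.T ∧
      c ∈ C.Sig (Set.range s) ∧ ∀ ν : hat T, s ν = p.cr ν := by
  obtain ⟨A, hA, hc⟩ := hc
  obtain ⟨T, s, hs, hT, hS, hsp, -⟩ := p.exists_system_of_mem_sig hA hc
  exact ⟨T, s, hs, hT, hS, hsp⟩

theorem isTreeCreatureAt_of_mem_sig (p : QTree C e) {ν : List α} (h : ν ∈ p.T)
    {c : WeakCreature H D} (hc : c ∈ C.Sig {p.cr ν}) : c.IsTreeCreatureAt ν := by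
  obtain ⟨T, s, hs, -, hS, -, r, rfl, hr⟩ := p.exists_system_of_mem_sig (A := {ν}) (by simpa using h)
    (by simpa using hc)
  obtain ⟨r', hr', hcr⟩ := (C.result T s hs c hS).1
  exact hr.unique hr' ▸ hcr

/-- The well-founded quasi tree in the definition of the order need not be mentioned: non-emptiness
of the value of `Σ` already produces a system, and its root is the node of the resulting creature.
-/
theorem le_iff {p q : QTree C e} : p ≤ q ↔ q.T ⊆ p.T ∧ ∀ ν ∈ q.T, q.cr ν ∈ p.gens := by
  constructor
  · rintro ⟨hT, h⟩
    refine ⟨hT, fun ν hν => ?_⟩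
    obtain ⟨T₀, -, -, hT₀, hS⟩ := h ⟨ν, hν⟩
    refine ⟨hat T₀, fun μ hμ => (hT₀ hμ.1).1, ?_⟩
    rw [q.cr_of_mem hν]
    convert hS using 2
    ext c
    constructor
    · rintro ⟨μ, hμ, rfl⟩
      exact ⟨⟨μ, (hT₀ hμ.1).1⟩, hμ, (p.cr_of_mem _).symm⟩
    · rintro ⟨μ, hμ, rfl⟩
      exact ⟨μ, hμ, p.cr_coe μ⟩
  · rintro ⟨hT, h⟩
    refine ⟨hT, fun ν => ?_⟩
    obtain ⟨T, s, hs, hTp, hS, hsp⟩ := p.exists_system_of_mem_gens (h ν ν.2)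
    obtain ⟨r, hr, hrc⟩ := (C.result T s hs _ hS).1
    obtain rfl : r = ν := hrc.unique (q.cr_creature ν.2)
    refine ⟨T, hs.quasi, hs.wf, fun μ hμ => ⟨hTp hμ, hr.2 μ hμ⟩, ?_⟩
    rw [← q.cr_coe]
    convert hS using 2
    ext c
    constructor
    · rintro ⟨μ, hμ, rfl⟩
      exact ⟨⟨μ, hμ⟩, (hsp _).trans (p.cr_coe μ)⟩
    · rintro ⟨μ, rfl⟩
      exact ⟨⟨μ, hTp μ.2.1⟩, μ.2, by rw [hsp, ← p.cr_coe]⟩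

/-- This is the transitivity axiom of `Σ`, and it makes the order transitive. -/
theorem gens_mono {p q : QTree C e} (h : p ≤ q) : q.gens ⊆ p.gens := by
  rintro c ⟨A, hA, hc⟩
  have h' := (le_iff.1 h).2
  have hex : ∀ s ∈ q.cr '' A, ∃ B ⊆ p.T, s ∈ C.Sig (p.cr '' B) := by
    rintro _ ⟨ν, hν, rfl⟩
    exact h' ν (hA hν)
  choose! B hB hsB using hex
  obtain ⟨hK, hcount⟩ := C.countable _ ⟨c, hc⟩
  refine ⟨⋃ s ∈ q.cr '' A, B s, Set.iUnion₂_subset hB, ?_⟩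
  rw [Set.image_iUnion₂]
  exact C.trans _ hK hcount (fun s => p.cr '' B s) hsB hc

theorem le_refl (p : QTree C e) : p ≤ p :=
  le_iff.2 ⟨subset_rfl, fun _ => p.cr_mem_gens⟩

theorem le_trans {p q r : QTree C e} (h : p ≤ q) (h' : q ≤ r) : p ≤ r := by
  obtain ⟨h2, h3⟩ := le_iff.1 h'
  exact le_iff.2 ⟨h2.trans (le_iff.1 h).1, fun ν hν => gens_mono h (h3 ν hν)⟩

theorem T_subset {p q : QTree C e} (h : p ≤ q) : q.T ⊆ p.T := (le_iff.1 h).1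

/-- A condition all of whose nodes and creatures belong to `p` is stronger than `p`. -/
theorem le_of_cr_eq {p q : QTree C e} (h : ∀ ν ∈ q.T, ν ∈ p.T ∧ q.cr ν = p.cr ν) : p ≤ q :=
  le_iff.2 ⟨fun ν hν => (h ν hν).1, fun ν hν => (h ν hν).2 ▸ p.cr_mem_gens (h ν hν).1⟩

theorem restr_cr (p : QTree C e) {η ν : List α} {hη : η ∈ p.T} (hν : ν ∈ (p.restr η hη).T) :
    (p.restr η hη).cr ν = p.cr ν := by
  rw [cr_of_mem _ hν, cr_of_mem _ hν.1]
  rfl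

theorem isRoot_restr (p : QTree C e) {η : List α} (hη : η ∈ p.T) : IsRoot (p.restr η hη).T η :=
  ⟨⟨hη, List.prefix_rfl⟩, fun _ h => h.2⟩

theorem le_restr (p : QTree C e) {η : List α} (hη : η ∈ p.T) : p ≤ p.restr η hη :=
  le_of_cr_eq fun _ hν => ⟨hν.1, p.restr_cr hν⟩

/-- The system that yields a creature at `ν` has root `ν`, so it lies entirely in the cone above
`η`. -/
theorem mem_gens_restr (p : QTree C e) {η ν : List α} (hη : η ∈ p.T) {c : WeakCreature H D}
    (hc : c ∈ p.gens) (hcν : c.IsTreeCreatureAt ν) (hην : η <+: ν) :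
    c ∈ (p.restr η hη).gens := by
  obtain ⟨T, s, hs, hTp, hS, hsp⟩ := p.exists_system_of_mem_gens hc
  obtain ⟨r, hr, hrc⟩ := (C.result T s hs _ hS).1
  obtain rfl := hrc.unique hcν
  have hmem : ∀ ρ ∈ hat T, ρ ∈ (p.restr η hη).T := fun ρ hρ => ⟨hTp hρ.1, hην.trans (hr.2 ρ hρ.1)⟩
  refine ⟨hat T, hmem, ?_⟩
  convert hS using 2
  ext c
  constructor
  · rintro ⟨μ, hμ, rfl⟩
    exact ⟨⟨μ, hμ⟩, by rw [hsp, p.restr_cr (hmem μ hμ)]⟩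
  · rintro ⟨μ, rfl⟩
    exact ⟨μ, μ.2, by rw [hsp, p.restr_cr (hmem μ μ.2)]⟩

theorem restr_le {p q : QTree C e} (h : p ≤ q) {η : List α} (hη : η ∈ p.T)
    (hq : ∀ ν ∈ q.T, η <+: ν) : p.restr η hη ≤ q :=
  le_iff.2 ⟨fun ν hν => ⟨T_subset h hν, hq ν hν⟩, fun ν hν =>
    p.mem_gens_restr hη ((le_iff.1 h).2 ν hν) (q.cr_creature hν) (hq ν hν)⟩

theorem restr_le_restr {p q : QTree C e} (h : p ≤ q) {η ν : List α} (hη : η ∈ p.T)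
    (hν : ν ∈ q.T) (hην : η <+: ν) : p.restr η hη ≤ q.restr ν hν :=
  restr_le (le_trans h (q.le_restr hν)) hη fun _ hρ => hην.trans hρ.2

theorem restr_root (p : QTree C e) {r : List α} (hr : IsRoot p.T r) : p.restr r hr.1 = p :=
  ext_cr (Set.ext fun ν => ⟨fun h => h.1, fun h => ⟨h, hr.2 ν h⟩⟩) fun _ hν => p.restr_cr hν

theorem decides_mono {p q : QTree C e} (h : p ≤ q) {τ : PName (QTree C e)} (hp : Decides p τ) :
    Decides q τ := hp.mono (fun _ _ _ => le_trans) h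

/-- Each node extends to a branch whose nodes may be chosen in any set that is cofinal in the
part of the tree above them. -/
theorem exists_branch (p : QTree C e) {S : Set (List α)} {η : List α} (hη : η ∈ S)
    (hS : ∀ ν ∈ S, ∃ μ ∈ S, ProperPrefix ν μ) (hSp : S ⊆ p.T) :
    ∃ x ∈ lim p.T, ∀ m, ∃ k, m ≤ k ∧ initSeg x k ∈ S := by
  choose! g hg hlt using hS
  let f : ℕ → List α := fun n => g^[n] η
  have hfS : ∀ n, f n ∈ S := by
    intro n
    induction n with
    | zero => exact hη
    | succ n ih =>
      simp only [f, Function.iterate_succ_apply'] at ih ⊢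
      exact hg _ ih
  have hf : ∀ n, ProperPrefix (f n) (f (n + 1)) := by
    intro n
    simp only [f, Function.iterate_succ_apply']
    exact hlt _ (hfS n)
  have hlen : ∀ n, n ≤ (f n).length := by
    intro n
    induction n with
    | zero => exact Nat.zero_le _
    | succ n ih => exact Nat.succ_le_of_lt (ih.trans_lt (hf n).length_lt)
  obtain ⟨x, hx⟩ := exists_branch_of_chain f hf
  have hk : ∀ m, ∃ k, m ≤ k ∧ initSeg x k ∈ S := fun m => ⟨_, hlen m, hx m ▸ hfS m⟩
  refine ⟨x, fun m => ?_, hk⟩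
  obtain ⟨k, hk, hkS⟩ := hk (m + 1)
  exact ⟨k, hk, hSp hkS⟩

end QTree

end TreeCreature

namespace TreeCreature

open Forcing

variable {α D : Type u} {H : ℕ → Set α} {C : TreeCreatingPair H D} {e : Fin 4}

namespace QTree

/-! ### Constructions of conditions -/

/-- The part of `p` above each element `η` of the antichain `A` is replaced by `f η`. -/
theorem exists_glue (p : QTree C e) {A : Set (List α)} (hA : A ⊆ p.T) (hanti : IsPrefixAntichain A)
    (f : List α → QTree C e) (hroot : ∀ η ∈ A, IsRoot (f η).T η) (hle : ∀ η ∈ A, p ≤ f η) :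
    ∃ q : QTree C e, p ≤ q ∧
      (∀ ν ∈ p.T, (∀ η ∈ A, ¬ η <+: ν) → ν ∈ q.T) ∧
      (∀ ν ∈ q.T, (∀ η ∈ A, ¬ η <+: ν) → q.cr ν = p.cr ν) ∧
      ∀ η ∈ A, ∃ h : η ∈ q.T, q.restr η h = f η := by
  classical
  have huniq : ∀ η ∈ A, ∀ η' ∈ A, ∀ ν, η <+: ν → η' <+: ν → η = η' :=
    fun η hη η' hη' ν h h' => hanti.eq hη hη' h h'
  let T : Set (List α) := {ν | (ν ∈ p.T ∧ ∀ η ∈ A, ¬ η <+: ν) ∨ ∃ η ∈ A, ν ∈ (f η).T}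
  let c : List α → WeakCreature H D := fun ν =>
    if h : ∃ η ∈ A, η <+: ν then (f h.choose).cr ν else p.cr ν
  have hcA : ∀ η ∈ A, ∀ ν, η <+: ν → c ν = (f η).cr ν := by
    intro η hη ν hην
    have h : ∃ η ∈ A, η <+: ν := ⟨η, hη, hην⟩
    simp only [c, dif_pos h]
    rw [huniq _ h.choose_spec.1 η hη ν h.choose_spec.2 hην]
  have hcp : ∀ ν, (∀ η ∈ A, ¬ η <+: ν) → c ν = p.cr ν := by
    intro ν hν
    have h : ¬ ∃ η ∈ A, η <+: ν := fun ⟨η, hη, h⟩ => hν η hη h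
    simp only [c, dif_neg h]
  have hTA : ∀ ν ∈ T, ∀ η ∈ A, η <+: ν → ν ∈ (f η).T := by
    rintro ν (⟨-, h⟩ | ⟨η', hη', hν⟩) η hη hην
    · exact (h η hη hην).elim
    · rwa [huniq η hη η' hη' ν hην ((hroot η' hη').2 ν hν)]
  have hTp : T ⊆ p.T := by
    rintro ν (h | ⟨η, hη, hν⟩)
    · exact h.1
    · exact T_subset (hle η hη) hν
  have hAT : A ⊆ T := fun η hη => Or.inr ⟨η, hη, (hroot η hη).1⟩
  have hcase : ∀ ν, (∀ η ∈ A, ¬ η <+: ν) ∨ ∃ η ∈ A, η <+: ν := fun ν => by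
    by_cases h : ∃ η ∈ A, η <+: ν
    · exact Or.inr h
    · exact Or.inl fun η hη h' => h ⟨η, hη, h'⟩
  have hfree : ∀ η ∈ A, (f η).T ⊆ T := fun η hη ν hν => Or.inr ⟨η, hη, hν⟩
  have hrT : ∃ r, IsRoot T r := by
    obtain ⟨r, hr⟩ := p.quasi
    rcases hcase r with h | ⟨η, hη, hηr⟩
    · exact ⟨r, Or.inl ⟨hr.1, h⟩, fun ν hν => hr.2 ν (hTp hν)⟩
    · obtain rfl := prefix_antisymm hηr (hr.2 η (hA hη))
      exact ⟨η, hAT hη, fun ν hν => hr.2 ν (hTp hν)⟩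
  obtain ⟨r, hr⟩ := hrT
  have hnorm : TotalNormCond T c e := by
    have hlimA : ∀ x ∈ lim T, ∀ η ∈ A, ∀ k, η = initSeg x k → x ∈ lim (f η).T := by
      rintro x hx η hη k rfl m
      obtain ⟨n, hn, hnT⟩ := hx (max m k)
      exact ⟨n, (_root_.le_max_left _ _).trans_lt hn, hTA _ hnT _ hη
        (initSeg_prefix_of_le x ((_root_.le_max_right _ _).trans hn.le))⟩
    -- A branch either never enters a cone above `A`, and then carries creatures of `p`, or is from
    -- some point on a branch of one `f η`.
    have hbr : ∀ x ∈ lim T, (∀ k, ∀ η ∈ A, ¬ η <+: initSeg x k) ∨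
        ∃ k, initSeg x k ∈ A ∧ x ∈ lim (f (initSeg x k)).T := by
      intro x hx
      by_cases h : ∃ k, ∃ η ∈ A, η <+: initSeg x k
      · obtain ⟨k, η, hη, hk⟩ := h
        have h2 := eq_initSeg_of_isPrefix hk
        exact Or.inr ⟨η.length, h2 ▸ hη, h2 ▸ hlimA x hx η hη _ h2⟩
      · exact Or.inl fun k η hη h' => h ⟨k, η, hη, h'⟩
    have hpn := p.totalNormCond
    have hfn := fun η => (f η).totalNormCond
    fin_cases e
    · intro x hx M m
      rcases hbr x hx with h | ⟨k, hk, hxk⟩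
      · obtain ⟨n, hn, hnT, hM⟩ := hpn x (lim_mono hTp hx) M m
        exact ⟨n, hn, Or.inl ⟨hnT, h n⟩, by rwa [hcp _ (h n)]⟩
      · obtain ⟨n, hn, hnT, hM⟩ := hfn _ x hxk M m
        exact ⟨n, hn, hfree _ hk hnT, by rwa [hcA _ hk _ ((hroot _ hk).2 _ hnT)]⟩
    · intro x hx M
      rcases hbr x hx with h | ⟨k, hk, hxk⟩
      · obtain ⟨m, hm⟩ := hpn x (lim_mono hTp hx) M
        exact ⟨m, fun n hn hnT => by rw [hcp _ (h n)]; exact hm n hn (hTp hnT)⟩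
      · obtain ⟨m, hm⟩ := hfn _ x hxk M
        refine ⟨max m k, fun n hn hnT => ?_⟩
        have hkn := initSeg_prefix_of_le x ((_root_.le_max_right _ _).trans hn)
        rw [hcA _ hk _ hkn]
        exact hm n ((_root_.le_max_left _ _).trans hn) (hTA _ hnT _ hk hkn)
    · have hin : ∀ η ∈ A, ∀ ν ∈ (f η).T, ∀ n : ℕ, ∃ ρ ∈ T, ProperPrefix ν ρ ∧
          (n : ℝ) ≤ (c ρ).nor := by
        intro η hη ν hν n
        obtain ⟨ρ, hρ, hlt, hn⟩ := hfn η ν hν n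
        exact ⟨ρ, hfree η hη hρ, hlt, by rwa [hcA η hη _ ((hroot η hη).2 _ hρ)]⟩
      rintro ν (⟨hν, hνA⟩ | ⟨η, hη, hν⟩) n
      · by_cases h : ∃ η ∈ A, ν <+: η
        · obtain ⟨η, hη, hνη⟩ := h
          obtain ⟨ρ, hρ, hlt, hn⟩ := hin η hη η (hroot η hη).1 n
          exact ⟨ρ, hρ, hνη.trans_properPrefix hlt, hn⟩
        · obtain ⟨ρ, hρ, hlt, hn⟩ := hpn ν hν n
          have hρA : ∀ η ∈ A, ¬ η <+: ρ := fun η hη hηρ => by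
            rcases prefix_total hηρ hlt.1 with h' | h'
            · exact hνA η hη h'
            · exact h ⟨η, hη, h'⟩
          exact ⟨ρ, Or.inl ⟨hρ, hρA⟩, hlt, by rwa [hcp _ hρA]⟩
      · exact hin η hη ν hν n
    · have hin : ∀ η ∈ A, ∀ ν ∈ (f η).T, ∀ n : ℕ, ∃ ρ ∈ T, ProperPrefix ν ρ ∧
          ∀ σ ∈ T, ProperPrefix ρ σ → (n : ℝ) ≤ (c σ).nor := by
        intro η hη ν hν n
        obtain ⟨ρ, hρ, hlt, hn⟩ := hfn η ν hν n
        refine ⟨ρ, hfree η hη hρ, hlt, fun σ hσ hρσ => ?_⟩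
        have hησ := ((hroot η hη).2 _ hρ).trans hρσ.1
        rw [hcA η hη _ hησ]
        exact hn σ (hTA _ hσ _ hη hησ) hρσ
      rintro ν (⟨hν, hνA⟩ | ⟨η, hη, hν⟩) n
      · by_cases h : ∃ η ∈ A, ν <+: η
        · obtain ⟨η, hη, hνη⟩ := h
          obtain ⟨ρ, hρ, hlt, hn⟩ := hin η hη η (hroot η hη).1 n
          exact ⟨ρ, hρ, hνη.trans_properPrefix hlt, hn⟩
        · obtain ⟨ρ, hρ, hlt, hn⟩ := hpn ν hν n
          have hσA : ∀ σ, ν <+: σ → ∀ η ∈ A, ¬ η <+: σ := fun σ hνσ η hη hησ => by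
            rcases prefix_total hησ hνσ with h' | h'
            · exact hνA η hη h'
            · exact h ⟨η, hη, h'⟩
          refine ⟨ρ, Or.inl ⟨hρ, hσA ρ hlt.1⟩, hlt, fun σ hσ hρσ => ?_⟩
          rw [hcp _ (hσA σ (hlt.1.trans hρσ.1))]
          exact hn σ (hTp hσ) hρσ
      · exact hin η hη ν hν n
  obtain ⟨q, hqT, hqc⟩ := exists_of_pass (C := C) (e := e) (T := T) (c := c) hr
    (fun ν _ => by
      simp only [c]
      split_ifs <;> exact cr_mem_K _ _)
    (fun ν hν => by
      rcases hcase ν with h | ⟨η, hη, hην⟩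
      · rw [hcp _ h]
        exact p.cr_creature (hTp hν)
      · rw [hcA η hη _ hην]
        exact (f η).cr_creature (hTA _ hν _ hη hην))
    (fun ν hν μ hμ => by
      rcases hcase ν with h | ⟨η, hη, hην⟩
      · rw [hcp _ h] at hμ
        rcases hcase μ with h' | ⟨η, hη, hημ⟩
        · exact Or.inl ⟨p.pos_cr_subset (hTp hν) hμ, h'⟩
        · have hlt := (p.cr_creature (hTp hν)).properPrefix hμ
          have hνη := (prefix_or_properPrefix hημ hlt.1).resolve_left (h η hη)
          rw [p.cr_pos (hTp hν)] at hμ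
          -- If a possibility of an unchanged node `ν` is above `η`, it is `η` itself; otherwise `η`
          -- would lie strictly between `ν` and its immediate successor.
          obtain rfl : η = μ := by
            by_contra hne
            exact hμ.2.2 ⟨η, hA hη, hνη, hημ, hne⟩
          exact hAT hη
      · rw [hcA η hη _ hην] at hμ
        exact hfree η hη ((f η).pos_cr_subset (hTA _ hν _ hη hην) hμ))
    (fun ν hν ρ hρ hlt => by
      rcases hcase ν with h | ⟨η, hη, hην⟩
      · rw [hcp _ h]
        exact p.exists_pos_isPrefix (hTp hν) (hTp hρ) hlt
      · rw [hcA η hη _ hην]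
        exact (f η).exists_pos_isPrefix (hTA _ hν _ hη hην) (hTA _ hρ _ hη (hην.trans hlt.1)) hlt)
    hnorm
  refine ⟨q, le_iff.2 ⟨hqT ▸ hTp, fun ν hν => ?_⟩, fun ν hν h => hqT ▸ Or.inl ⟨hν, h⟩,
    fun ν hν h => (hqc ν (hqT ▸ hν)).trans (hcp ν h), fun η hη => ⟨hqT ▸ hAT hη, ?_⟩⟩
  · rw [hqT] at hν
    rw [hqc ν hν]
    rcases hcase ν with h | ⟨η, hη, hην⟩
    · exact hcp _ h ▸ p.cr_mem_gens (hTp hν)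
    · exact hcA η hη _ hην ▸ (le_iff.1 (hle η hη)).2 ν (hTA _ hν _ hη hην)
  · refine ext_cr (Set.ext fun ν => ⟨fun h => hTA _ (hqT ▸ h.1) _ hη h.2, fun h =>
      ⟨hqT ▸ hfree η hη h, (hroot η hη).2 _ h⟩⟩) fun ν hν => ?_
    rw [q.restr_cr hν, hqc ν (hqT ▸ hν.1), hcA η hη _ hν.2]

/-- A condition with a given creature at the root and given conditions above its possibilities. -/
theorem exists_amalgamation (he : e = 0 ∨ e = 1) {p : QTree C e} {ν : List α} (hν : ν ∈ p.T)
    {s : WeakCreature H D} (hs : s.IsTreeCreatureAt ν) (hsp : s ∈ p.gens)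
    (f : List α → QTree C e) (hroot : ∀ μ ∈ s.pos, IsRoot (f μ).T μ) (hle : ∀ μ ∈ s.pos, p ≤ f μ) :
    ∃ q : QTree C e, p ≤ q ∧ IsRoot q.T ν ∧ q.cr ν = s ∧
      ∀ ρ, ∀ hρ : ρ ∈ q.T, ρ = ν ∨ ∃ μ ∈ s.pos, μ <+: ρ ∧ f μ ≤ q.restr ρ hρ ∧ ρ ∈ (f μ).T ∧
        q.cr ρ = (f μ).cr ρ := by
  classical
  let T : Set (List α) := {ρ | ρ = ν ∨ ∃ μ ∈ s.pos, ρ ∈ (f μ).T}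
  let c : List α → WeakCreature H D := fun ρ =>
    if h : ∃ μ ∈ s.pos, μ <+: ρ then (f h.choose).cr ρ else s
  have hcA : ∀ μ ∈ s.pos, ∀ ρ, μ <+: ρ → c ρ = (f μ).cr ρ := by
    intro μ hμ ρ hμρ
    have h : ∃ μ ∈ s.pos, μ <+: ρ := ⟨μ, hμ, hμρ⟩
    simp only [c, dif_pos h]
    rw [hs.2.eq h.choose_spec.1 hμ h.choose_spec.2 hμρ]
  have hcν : c ν = s := by
    have h : ¬ ∃ μ ∈ s.pos, μ <+: ν := fun ⟨μ, hμ, h⟩ => (hs.properPrefix hμ).not_isPrefix h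
    simp only [c, dif_neg h]
  have hνle : ∀ ρ ∈ T, ν <+: ρ := by
    rintro ρ (rfl | ⟨μ, hμ, hρ⟩)
    · exact List.prefix_rfl
    · exact (hs.properPrefix hμ).1.trans ((hroot μ hμ).2 _ hρ)
  have hTA : ∀ ρ ∈ T, ∀ μ ∈ s.pos, μ <+: ρ → ρ ∈ (f μ).T := by
    rintro ρ (rfl | ⟨μ', hμ', hρ⟩) μ hμ hμρ
    · exact ((hs.properPrefix hμ).not_isPrefix hμρ).elim
    · rwa [hs.2.eq hμ hμ' hμρ ((hroot μ' hμ').2 _ hρ)]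
  have hTp : T ⊆ p.T := by
    rintro ρ (rfl | ⟨μ, hμ, hρ⟩)
    · exact hν
    · exact T_subset (hle μ hμ) hρ
  have hfree : ∀ μ ∈ s.pos, (f μ).T ⊆ T := fun μ hμ ρ hρ => Or.inr ⟨μ, hμ, hρ⟩
  have hbr : ∀ x ∈ lim T, ∃ μ ∈ s.pos, x ∈ lim (f μ).T := by
    intro x hx
    obtain ⟨n, hn, hnT⟩ := hx ν.length
    rcases hnT with h | ⟨μ, hμ, hρ⟩
    · simp [← h] at hn
    · refine ⟨μ, hμ, fun m => ?_⟩
      obtain ⟨k, hk, hkT⟩ := hx (max m n)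
      exact ⟨k, (_root_.le_max_left _ _).trans_lt hk, hTA _ hkT _ hμ (((hroot μ hμ).2 _ hρ).trans
        (initSeg_prefix_of_le x ((_root_.le_max_right _ _).trans hk.le)))⟩
  have hnorm : TotalNormCond T c e := by
    have hfn := fun η => (f η).totalNormCond
    rcases he with rfl | rfl
    · intro x hx M m
      obtain ⟨μ, hμ, hxμ⟩ := hbr x hx
      obtain ⟨n, hn, hnT, hM⟩ := hfn _ x hxμ M m
      exact ⟨n, hn, hfree _ hμ hnT, by rwa [hcA _ hμ _ ((hroot _ hμ).2 _ hnT)]⟩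
    · intro x hx M
      obtain ⟨μ, hμ, hxμ⟩ := hbr x hx
      obtain ⟨m, hm⟩ := hfn _ x hxμ M
      obtain ⟨k, hk, hkT⟩ := hxμ m
      refine ⟨k, fun n hn hnT => ?_⟩
      have hkn := ((hroot _ hμ).2 _ hkT).trans (initSeg_prefix_of_le x hn)
      rw [hcA _ hμ _ hkn]
      exact hm n (hk.le.trans hn) (hTA _ hnT _ hμ hkn)
  obtain ⟨q, hqT, hqc⟩ := exists_of_pass (C := C) (e := e) (T := T) (c := c) (r := ν)
    ⟨Or.inl rfl, hνle⟩
    (fun ρ _ => by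
      simp only [c]
      split_ifs
      · exact cr_mem_K _ _
      · exact p.gens_subset_K hsp)
    (by
      rintro ρ (rfl | ⟨μ, hμ, hρ⟩)
      · rwa [hcν]
      · rw [hcA μ hμ _ ((hroot μ hμ).2 _ hρ)]
        exact (f μ).cr_creature hρ)
    (by
      rintro ρ (rfl | ⟨μ, hμ, hρ⟩)
      · rw [hcν]
        exact fun μ hμ => hfree μ hμ (hroot μ hμ).1
      · rw [hcA μ hμ _ ((hroot μ hμ).2 _ hρ)]
        exact ((f μ).pos_cr_subset hρ).trans (hfree μ hμ))
    (by
      rintro ρ (rfl | ⟨μ, hμ, hρ⟩) σ hσ hlt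
      · rw [hcν]
        rcases hσ with rfl | ⟨μ, hμ, hσ⟩
        · exact (hlt.2 rfl).elim
        · exact ⟨μ, hμ, (hroot μ hμ).2 _ hσ⟩
      · have hμρ := (hroot μ hμ).2 _ hρ
        rw [hcA μ hμ _ hμρ]
        exact (f μ).exists_pos_isPrefix hρ (hTA _ hσ _ hμ (hμρ.trans hlt.1)) hlt)
    hnorm
  refine ⟨q, le_iff.2 ⟨hqT ▸ hTp, ?_⟩, hqT ▸ ⟨Or.inl rfl, hνle⟩, (hqc ν (Or.inl rfl)).trans hcν, ?_⟩
  · rw [hqT]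
    rintro ρ (rfl | ⟨μ, hμ, hρ⟩)
    · rwa [hqc _ (Or.inl rfl), hcν]
    · rw [hqc _ (hfree μ hμ hρ), hcA μ hμ _ ((hroot μ hμ).2 _ hρ)]
      exact (le_iff.1 (hle μ hμ)).2 ρ hρ
  · intro ρ hρq
    have hcr : ∀ μ ∈ s.pos, ∀ σ ∈ q.T, μ <+: σ → q.cr σ = (f μ).cr σ := fun μ hμ σ hσ h => by
      rw [hqc σ (hqT ▸ hσ), hcA μ hμ _ h]
    rcases (hqT ▸ hρq : ρ ∈ T) with rfl | ⟨μ, hμ, hρ⟩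
    · exact Or.inl rfl
    · have hμρ := (hroot μ hμ).2 _ hρ
      refine Or.inr ⟨μ, hμ, hμρ, le_of_cr_eq fun σ hσ => ?_, hρ, hcr μ hμ ρ hρq hμρ⟩
      have hμσ := hμρ.trans hσ.2
      exact ⟨hTA _ (hqT ▸ hσ.1) _ hμ hμσ, (q.restr_cr hσ).trans (hcr μ hμ σ hσ.1 hμσ)⟩

/-- The nodes reached from `ν` through the possibilities of the creatures `σ`. -/
inductive Reach (σ : List α → WeakCreature H D) (ν : List α) : List α → Prop
  | root : Reach σ ν ν
  | step {ρ μ : List α} : Reach σ ν ρ → μ ∈ (σ ρ).pos → Reach σ ν μ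

theorem Reach.mem {σ : List α → WeakCreature H D} {ν ρ : List α} {S : Set (List α)}
    (hν : ν ∈ S) (hS : ∀ ρ ∈ S, (σ ρ).pos ⊆ S) (h : Reach σ ν ρ) : ρ ∈ S := by
  induction h with
  | root => exact hν
  | step _ hμ ih => exact hS _ ih hμ

theorem Reach.isPrefix {σ : List α → WeakCreature H D} {ν ρ : List α}
    (hσ : ∀ ρ, Reach σ ν ρ → (σ ρ).IsTreeCreatureAt ρ) (h : Reach σ ν ρ) : ν <+: ρ := by
  induction h with
  | root => exact List.prefix_rfl
  | step h hμ ih => exact ih.trans ((hσ _ h).properPrefix hμ).1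

/-- Let `ρ₂` be a possibility at `ρ`. If `ρ₁` is an initial segment of `ρ`, descend to `ρ`.
Otherwise the induction with the roles exchanged gives a possibility at `ρ` below `ρ₁`, hence
properly below `ρ₂`, against the antichain property of possibilities. -/
theorem Reach.exists_pos_isPrefix {σ : List α → WeakCreature H D} {ν : List α}
    (hσ : ∀ ρ, Reach σ ν ρ → (σ ρ).IsTreeCreatureAt ρ) {ρ₁ ρ₂ : List α} (h₁ : Reach σ ν ρ₁)
    (h₂ : Reach σ ν ρ₂) (hlt : ProperPrefix ρ₁ ρ₂) : ∃ μ ∈ (σ ρ₁).pos, μ <+: ρ₂ := by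
  induction hn : ρ₁.length + ρ₂.length using Nat.strong_induction_on generalizing ρ₁ ρ₂ with
  | _ n ih =>
    cases h₂ with
    | root => exact (hlt.not_isPrefix (h₁.isPrefix hσ)).elim
    | @step ρ _ h hμ =>
      have hρ := (hσ _ h).properPrefix hμ
      rcases prefix_or_properPrefix hlt.1 hρ.1 with h1 | h1
      · by_cases heq : ρ₁ = ρ
        · exact ⟨ρ₂, heq ▸ hμ, List.prefix_rfl⟩
        · obtain ⟨μ, hμ', h2⟩ := ih _ (by have := hρ.length_lt; omega) h₁ h ⟨h1, heq⟩ rfl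
          exact ⟨μ, hμ', h2.trans hρ.1⟩
      · obtain ⟨μ, hμ', h2⟩ := ih _ (by have := hρ.length_lt; omega) h h₁ h1 rfl
        exact ((hσ _ h).2 _ hμ' _ hμ (h2.trans_properPrefix hlt)).elim

/-- The creatures of `p` on a set `S` of nodes are replaced by creatures `σ` whose possibilities
lie in `S`. -/
theorem exists_prune {p : QTree C 1} {S : Set (List α)} (hSp : S ⊆ p.T) {ν : List α} (hν : ν ∈ S)
    (σ : List α → WeakCreature H D) (hσ : ∀ ρ ∈ S, σ ρ ∈ C.Sig {p.cr ρ})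
    (hpos : ∀ ρ ∈ S, (σ ρ).pos ⊆ S) (hnor : ∀ ρ ∈ S, (p.cr ρ).nor - 1 ≤ (σ ρ).nor) :
    ∃ q : QTree C 1, p ≤ q ∧ q.T ⊆ S := by
  have hTS : {ρ | Reach σ ν ρ} ⊆ S := fun ρ h => Reach.mem hν hpos h
  have hcr : ∀ ρ ∈ S, (σ ρ).IsTreeCreatureAt ρ := by
    intro ρ hρ
    exact p.isTreeCreatureAt_of_mem_sig (hSp hρ) (hσ ρ hρ)
  have hσR : ∀ ρ, Reach σ ν ρ → (σ ρ).IsTreeCreatureAt ρ := fun ρ h => hcr ρ (hTS h)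
  obtain ⟨q, hqT, hqc⟩ := exists_of_pass (C := C) (e := 1) (T := {ρ | Reach σ ν ρ}) (c := σ) (r := ν)
    ⟨Reach.root, fun ρ h => Reach.isPrefix hσR h⟩ (fun ρ hρ => C.sig_subset _ (hσ ρ (hTS hρ))) hσR
    (fun ρ hρ μ hμ => Reach.step hρ hμ) (fun ρ hρ μ hμ h => Reach.exists_pos_isPrefix hσR hρ hμ h)
    (fun x hx M => by
      obtain ⟨m, hm⟩ := p.totalNormCond x (lim_mono (hTS.trans hSp) hx) (M + 1)
      refine ⟨m, fun k hk hkT => ?_⟩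
      have := hm k hk (hSp (hTS hkT))
      have := hnor _ (hTS hkT)
      linarith)
  refine ⟨q, le_iff.2 ⟨hqT ▸ hTS.trans hSp, fun ρ hρ => ?_⟩, hqT ▸ hTS⟩
  rw [hqT] at hρ
  rw [hqc ρ hρ]
  exact p.sig_subset_gens (hSp (hTS hρ)) (hσ ρ (hTS hρ))

end QTree

end TreeCreature

namespace TreeCreature

open Forcing

variable {α D : Type u} {H : ℕ → Set α} {C : TreeCreatingPair H D} {e : Fin 4}

namespace QTree

/-! ### Fusion along antichains -/

/-- A family of sets of nodes that antichains are required to meet: the trees of stronger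
conditions for thick antichains, the branches for fronts. -/
structure IsTestFamily (𝓑 : QTree C e → Set (Set (List α))) : Prop where
  subset : ∀ p, ∀ B ∈ 𝓑 p, B ⊆ p.T
  nonempty : ∀ p, ∀ B ∈ 𝓑 p, B.Nonempty
  mono : ∀ p q, p ≤ q → 𝓑 q ⊆ 𝓑 p
  restr : ∀ p, ∀ B ∈ 𝓑 p, ∀ ν ∈ dcl B, ∀ h : ν ∈ p.T,
    ∃ B' ∈ 𝓑 (p.restr ν h), B' ⊆ B ∧ ∀ μ ∈ B', ProperPrefix ν μ
  cone : e = 2 ∨ e = 3 → ∀ (p : QTree C e) (η : List α) (h : η ∈ p.T), (p.restr η h).T ∈ 𝓑 p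

/-- The norms of `q`, a condition stronger than `p`, are at least `M` where the norm condition
asks for it. -/
structure IsLarge (M : ℝ) (p q : QTree C e) : Prop where
  root : e = 0 ∨ e = 2 → ∀ ν, IsRoot q.T ν → M ≤ (q.cr ν).nor
  new : e = 1 → ∀ ν ∈ q.T, q.cr ν = p.cr ν ∨ M ≤ (q.cr ν).nor
  all : e = 3 → ∀ ν ∈ q.T, M ≤ (q.cr ν).nor

theorem IsLarge.of_restr {M : ℝ} {p q : QTree C e} {ν : List α} {h : ν ∈ p.T}
    (hle : p.restr ν h ≤ q) (hq : IsLarge M (p.restr ν h) q) : IsLarge M p q :=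
  ⟨hq.root, fun he ρ hρ => p.restr_cr (T_subset hle hρ) ▸ hq.new he ρ hρ, hq.all⟩

/-- An antichain of `p` that meets all tests and whose cones belong to `𝒮`. -/
structure IsFusionState (𝓑 : QTree C e → Set (Set (List α))) (𝒮 : Set (QTree C e))
    (p : QTree C e) (A : Set (List α)) : Prop where
  subset : A ⊆ p.T
  antichain : IsPrefixAntichain A
  hits : ∀ B ∈ 𝓑 p, (A ∩ dcl B).Nonempty
  mem : ∀ ν ∈ A, ∃ h : ν ∈ p.T, p.restr ν h ∈ 𝒮

/-- `q` is obtained from `p` by changes above the elements of `A'`, which lie above those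
of `A`. -/
structure IsFusionStep (M : ℝ) (p : QTree C e) (A : Set (List α)) (q : QTree C e)
    (A' : Set (List α)) : Prop where
  le : p ≤ q
  mem : ∀ ν ∈ p.T, (∀ η ∈ A', ¬ η <+: ν) → ν ∈ q.T
  cr_eq : ∀ ν ∈ q.T, (∀ η ∈ A', ¬ η <+: ν) → q.cr ν = p.cr ν
  above : ∀ μ ∈ A', ∃ ν ∈ A, ProperPrefix ν μ
  large : e = 0 ∨ e = 2 → ∀ μ ∈ A', M ≤ (q.cr μ).nor
  new : e = 1 → ∀ ν ∈ q.T, q.cr ν = p.cr ν ∨ M ≤ (q.cr ν).nor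
  all : e = 3 → ∀ μ ∈ A', ∀ ν ∈ q.T, μ <+: ν → M ≤ (q.cr ν).nor

/-- Each `p ∈ 𝒮` has, along each test, stronger conditions in `𝒮'` with large norms. -/
def IsDenseAlong (𝓑 : QTree C e → Set (Set (List α))) (M : ℝ) (𝒮 𝒮' : Set (QTree C e)) : Prop :=
  ∀ p ∈ 𝒮, ∀ B ∈ 𝓑 p, ∃ μ ∈ B, ∃ q ∈ 𝒮', IsRoot q.T μ ∧ p ≤ q ∧ IsLarge M p q

/-- The new antichain consists of the minimal points of the set `Z` of all admissible roots above
`A`. It meets a test because `A` does: the part of the test strictly above a point of `A` contains a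
test of the cone there, and density puts an element of `Z` into it. -/
theorem exists_fusionStep {𝓑 : QTree C e → Set (Set (List α))} (h𝓑 : IsTestFamily 𝓑) {M : ℝ}
    {𝒮 𝒮' : Set (QTree C e)} (hd : IsDenseAlong 𝓑 M 𝒮 𝒮') {p : QTree C e} {A : Set (List α)}
    (hA : IsFusionState 𝓑 𝒮 p A) :
    ∃ q A', IsFusionState 𝓑 𝒮' q A' ∧ IsFusionStep M p A q A' := by
  let Z : Set (List α) := {μ | ∃ ν ∈ A, ProperPrefix ν μ ∧ ∃ h : ν ∈ p.T, ∃ q ∈ 𝒮',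
    IsRoot q.T μ ∧ p.restr ν h ≤ q ∧ IsLarge M (p.restr ν h) q}
  have hZ : ∀ μ ∈ minPts Z, ∃ q ∈ 𝒮', IsRoot q.T μ ∧ p ≤ q ∧ (∃ ν ∈ A, ProperPrefix ν μ) ∧
      IsLarge M p q := by
    rintro μ ⟨⟨ν, hν, hlt, h, q, hq, hr, hle, hg⟩, -⟩
    refine ⟨q, hq, hr, le_trans (p.le_restr h) hle, ⟨ν, hν, hlt⟩, hg.of_restr hle⟩
  have : Nonempty (QTree C e) := ⟨p⟩
  choose! f hf𝒮 hroot hle habove hlarge using hZ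
  have hsub : minPts Z ⊆ p.T := fun μ hμ => T_subset (hle μ hμ) (hroot μ hμ).1
  obtain ⟨q, hpq, hmem, hcr, hres⟩ := p.exists_glue hsub (isPrefixAntichain_minPts Z) f hroot hle
  have hcrf : ∀ μ ∈ minPts Z, ∀ ν ∈ q.T, μ <+: ν → ν ∈ (f μ).T ∧ q.cr ν = (f μ).cr ν := by
    intro μ hμ ν hν hμν
    obtain ⟨h, heq⟩ := hres μ hμ
    have h2 : ν ∈ (q.restr μ h).T := ⟨hν, hμν⟩
    have h3 := q.restr_cr h2
    rw [heq] at h2 h3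
    exact ⟨h2, h3.symm⟩
  refine ⟨q, minPts Z, ⟨fun μ hμ => (hres μ hμ).1, isPrefixAntichain_minPts Z, fun B hB => ?_,
    fun μ hμ => ?_⟩, ⟨hpq, hmem, hcr, habove, fun he μ hμ => ?_, fun he ν hν => ?_,
    fun he μ hμ ν hν hμν => ?_⟩⟩
  · have hBp := h𝓑.mono p q hpq hB
    obtain ⟨ν, hν, hνB⟩ := hA.hits B hBp
    obtain ⟨h, hν𝒮⟩ := hA.mem ν hν
    obtain ⟨B', hB', hsub', hlt⟩ := h𝓑.restr p B hBp ν hνB h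
    obtain ⟨μ, hμ, q', hq', hr, hle', hg⟩ := hd _ hν𝒮 B' hB'
    obtain ⟨μ', hμ', hpre⟩ := exists_minPts_isPrefix (Z := Z) (μ := μ)
      ⟨ν, hν, hlt μ hμ, h, q', hq', hr, hle', hg⟩
    exact ⟨μ', hμ', μ, hsub' hμ, hpre⟩
  · obtain ⟨h, heq⟩ := hres μ hμ
    exact ⟨h, heq ▸ hf𝒮 μ hμ⟩
  · rw [(hcrf μ hμ μ (hres μ hμ).1 List.prefix_rfl).2]
    exact (hlarge μ hμ).root he μ (hroot μ hμ)
  · by_cases h : ∃ η ∈ minPts Z, η <+: ν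
    · obtain ⟨η, hη, hην⟩ := h
      obtain ⟨h1, h2⟩ := hcrf η hη ν hν hην
      rw [h2]
      exact (hlarge η hη).new he ν h1
    · exact Or.inl (hcr ν hν fun η hη h' => h ⟨η, hη, h'⟩)
  · obtain ⟨h1, h2⟩ := hcrf μ hμ ν hν hμν
    rw [h2]
    exact (hlarge μ hμ).all he ν h1

theorem _root_.exists_sequence_of_step {σ : Type*} (I : ℕ → σ → Prop) (R : ℕ → σ → σ → Prop)
    {s : σ} (hs : I 0 s) (h : ∀ k s, I k s → ∃ s', I (k + 1) s' ∧ R k s s') :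
    ∃ f : ℕ → σ, f 0 = s ∧ ∀ k, I k (f k) ∧ R k (f k) (f (k + 1)) := by
  have : Nonempty σ := ⟨s⟩
  choose! g hI hR using h
  let f : ℕ → σ := fun k => Nat.rec s (fun k s => g k s) k
  have hf : ∀ k, I k (f k) := fun k => by
    induction k with
    | zero => exact hs
    | succ k ih => exact hI k _ ih
  exact ⟨f, rfl, fun k => ⟨hf k, hR k _ (hf k)⟩⟩


end QTree

end TreeCreature

/-! ### Limits of fusion sequences -/

namespace TreeCreature

open Forcing

variable {α D : Type u} {H : ℕ → Set α} {C : TreeCreatingPair H D} {e : Fin 4}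

namespace QTree

/-- A sequence of fusion steps. -/
structure IsFusion (𝓑 : QTree C e → Set (Set (List α))) (𝒮 : ℕ → Set (QTree C e)) (n : ℕ)
    (p : ℕ → QTree C e) (A : ℕ → Set (List α)) : Prop where
  state : ∀ k, IsFusionState 𝓑 (𝒮 k) (p k) (A k)
  step : ∀ k : ℕ, IsFusionStep ((k : ℝ) + n) (p k) (A k) (p (k + 1)) (A (k + 1))

namespace IsFusion

variable {𝓑 : QTree C e → Set (Set (List α))} {𝒮 : ℕ → Set (QTree C e)} {n : ℕ}
  {p : ℕ → QTree C e} {A : ℕ → Set (List α)}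

/-- The nodes of `p k` that are not changed any more. -/
def settled (p : ℕ → QTree C e) (A : ℕ → Set (List α)) (k : ℕ) : Set (List α) :=
  {ν ∈ (p k).T | ∀ η ∈ A (k + 1), ¬ η <+: ν}

theorem le (h : IsFusion 𝓑 𝒮 n p A) {j k : ℕ} (hjk : j ≤ k) : p j ≤ p k := by
  induction k, hjk using Nat.le_induction with
  | base => exact le_refl _
  | succ k _ ih => exact le_trans ih (h.step k).le

theorem settled_succ (h : IsFusion 𝓑 𝒮 n p A) {k : ℕ} {ν : List α} (hν : ν ∈ settled p A k) :
    ν ∈ settled p A (k + 1) ∧ (p (k + 1)).cr ν = (p k).cr ν := by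
  have hT := (h.step k).mem ν hν.1 hν.2
  refine ⟨⟨hT, fun η hη hην => ?_⟩, (h.step k).cr_eq ν hT hν.2⟩
  obtain ⟨η', hη', hlt⟩ := (h.step (k + 1)).above η hη
  exact hν.2 η' hη' (hlt.1.trans hην)

theorem settled_mono (h : IsFusion 𝓑 𝒮 n p A) {j k : ℕ} (hjk : j ≤ k) {ν : List α}
    (hν : ν ∈ settled p A j) : ν ∈ settled p A k ∧ (p k).cr ν = (p j).cr ν := by
  induction k, hjk using Nat.le_induction with
  | base => exact ⟨hν, rfl⟩
  | succ k _ ih =>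
    obtain ⟨h1, h2⟩ := h.settled_succ ih.1
    exact ⟨h1, h2.trans ih.2⟩

theorem antichain_subset_settled (h : IsFusion 𝓑 𝒮 n p A) (k : ℕ) : A k ⊆ settled p A k := by
  refine fun ν hν => ⟨(h.state k).subset hν, fun η hη hην => ?_⟩
  obtain ⟨η', hη', hlt⟩ := (h.step k).above η hη
  exact (h.state k).antichain η' hη' ν hν (hlt.trans_isPrefix hην)

/-- If a possibility `μ` of a settled node `ν` were above `A (k + 2)`, it would be properly above
some `η' ∈ A (k + 1)`. As `ν` is not above `η'`, the node `η'` would separate `ν` from its immediate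
successor `μ`. This makes the settled nodes closed under possibilities in the limit. -/
theorem pos_subset_settled (h : IsFusion 𝓑 𝒮 n p A) {k : ℕ} {ν : List α}
    (hν : ν ∈ settled p A k) : ((p k).cr ν).pos ⊆ settled p A (k + 1) := by
  intro μ hμ
  obtain ⟨h1, h2⟩ := h.settled_succ hν
  rw [← h2, (p (k + 1)).cr_pos h1.1] at hμ
  refine ⟨hμ.1, fun η hη hημ => ?_⟩
  obtain ⟨η', hη', hlt⟩ := (h.step (k + 1)).above η hη
  have hlt' := hlt.trans_isPrefix hημ
  have hνη := (prefix_or_properPrefix hlt'.1 hμ.2.1.1).resolve_left (hν.2 η' hη')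
  exact hμ.2.2 ⟨η', (h.state (k + 1)).subset hη', hνη, hlt'⟩

theorem new (h : IsFusion 𝓑 𝒮 n p A) (he : e = 1) {j k : ℕ} (hjk : j ≤ k) {ν : List α}
    (hν : ν ∈ (p k).T) : (p k).cr ν = (p j).cr ν ∨ (j : ℝ) + n ≤ ((p k).cr ν).nor := by
  induction k, hjk using Nat.le_induction with
  | base => exact Or.inl rfl
  | succ k hk ih =>
    have hk' : (j : ℝ) ≤ k := by exact_mod_cast hk
    rcases (h.step k).new he ν hν with h1 | h1
    · rw [h1]
      exact ih (T_subset (h.step k).le hν)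
    · exact Or.inr (by linarith)

theorem all (h : IsFusion 𝓑 𝒮 n p A) (he : e = 3) {j k : ℕ} (hjk : j + 1 ≤ k) {μ ν : List α}
    (hμ : μ ∈ A (j + 1)) (hν : ν ∈ (p k).T) (hμν : μ <+: ν) : (j : ℝ) + n ≤ ((p k).cr ν).nor := by
  induction k, hjk using Nat.le_induction with
  | base => exact (h.step j).all he μ hμ ν hν hμν
  | succ k hk ih =>
    have hk' : (j : ℝ) ≤ k := by exact_mod_cast (Nat.le_succ j).trans hk
    by_cases h1 : ∃ η ∈ A (k + 1), η <+: ν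
    · obtain ⟨η, hη, hην⟩ := h1
      have := (h.step k).all he η hη ν hν hην
      linarith
    · rw [(h.step k).cr_eq ν hν fun η hη h' => h1 ⟨η, hη, h'⟩]
      exact ih (T_subset (h.step k).le hν)

/-- The limit of a sequence of fusion steps. -/
theorem exists_limit (h : IsFusion 𝓑 𝒮 n p A) (h𝓑 : IsTestFamily 𝓑) :
    ∃ q : QTree C e, (∀ k, p k ≤ q) ∧
      (∀ k, ∀ ν ∈ settled p A k, ν ∈ q.T ∧ q.cr ν = (p k).cr ν) ∧
      ∀ ν ∈ q.T, ∃ k, ν ∈ settled p A k := by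
  classical
  let T : Set (List α) := ⋃ k, settled p A k
  let c : List α → WeakCreature H D := fun ν =>
    if h : ∃ k, ν ∈ settled p A k then (p h.choose).cr ν else (p 0).cr ν
  have hc : ∀ k, ∀ ν ∈ settled p A k, c ν = (p k).cr ν := by
    intro k ν hν
    have hex : ∃ k, ν ∈ settled p A k := ⟨k, hν⟩
    simp only [c, dif_pos hex]
    rcases le_total hex.choose k with h1 | h1
    · exact (h.settled_mono h1 hex.choose_spec).2.symm
    · exact (h.settled_mono h1 hν).2
  have hsT : ∀ k, settled p A k ⊆ T := fun k => Set.subset_iUnion _ k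
  have hTlarge : ∀ k, ∀ ν ∈ T, ∃ j, k ≤ j ∧ ν ∈ settled p A j := by
    intro k ν hν
    obtain ⟨j, hj⟩ := Set.mem_iUnion.1 hν
    exact ⟨max k j, le_max_left _ _, (h.settled_mono (le_max_right _ _) hj).1⟩
  have hTp : ∀ k, T ⊆ (p k).T := by
    intro k ν hν
    obtain ⟨j, hj, hνj⟩ := hTlarge k ν hν
    exact T_subset (h.le hj) hνj.1
  obtain ⟨r, hr⟩ := (p 0).quasi
  -- The root is settled from the start, since `A 1` lies properly above nodes of `A 0`.
  have hrT : r ∈ T := hsT 0 ⟨hr.1, fun η hη hηr => by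
    obtain ⟨η', hη', hlt⟩ := (h.step 0).above η hη
    exact (hlt.trans_isPrefix hηr).not_isPrefix (hr.2 _ ((h.state 0).subset hη'))⟩
  -- Here cones are tests, so arbitrarily late antichains have points above any given node. The node
  -- being settled, these points are properly above it.
  have hcone : e = 2 ∨ e = 3 → ∀ k, ∀ ν ∈ T, ∃ j, k ≤ j ∧ ∃ η ∈ A (j + 1), ProperPrefix ν η := by
    intro he k ν hν
    obtain ⟨j, hj, hνj⟩ := hTlarge k ν hν
    obtain ⟨η, hη, ρ, hρ, hηρ⟩ := (h.state (j + 1)).hits _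
      (h𝓑.cone he (p (j + 1)) ν (hTp (j + 1) hν))
    exact ⟨j, hj, η, hη, (prefix_or_properPrefix hηρ hρ.2).resolve_left (hνj.2 η hη)⟩
  have hnorm : TotalNormCond T c e := by
    have hpn := fun k => (p k).totalNormCond
    have hlarge := fun k => (h.step k).large
    have hnew := fun he j k hjk ν hν => h.new (j := j) (k := k) (ν := ν) he hjk hν
    have hall := fun he j k hjk μ ν hμ hν => h.all (j := j) (k := k) (μ := μ) (ν := ν) he hjk hμ hν
    clear_value T c
    fin_cases e
    · intro x hx M m
      -- A branch that misses `A (k + 1)` is settled at stage `k` and inherits its norms from `p k`.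
      -- A branch that meets all of them has norms at least `k + n` at the meeting points.
      by_cases hcase : ∃ k, ∀ i, initSeg x i ∉ A (k + 1)
      · obtain ⟨k, hk⟩ := hcase
        obtain ⟨i, hi, hiT, hM⟩ := hpn k x (lim_mono (hTp k) hx) M m
        have his : initSeg x i ∈ settled p A k := ⟨hiT, fun η hη hηi =>
          hk η.length (eq_initSeg_of_isPrefix hηi ▸ hη)⟩
        exact ⟨i, hi, hsT k his, by rwa [hc k _ his]⟩
      · push Not at hcase
        -- `K` bounds the norms at initial segments shorter than `m`; a meeting point of norm above
        -- `K` therefore has length at least `m`.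
        obtain ⟨K, hK⟩ := ((Set.finite_Iio m).image fun i => (c (initSeg x i)).nor).bddAbove
        obtain ⟨k, hk⟩ := exists_nat_gt (max K M)
        obtain ⟨i, hi⟩ := hcase k
        have his := h.antichain_subset_settled (k + 1) hi
        have hki : (k : ℝ) ≤ (c (initSeg x i)).nor := by
          rw [hc _ _ his]
          have := hlarge k (Or.inl rfl) _ hi
          have : (0 : ℝ) ≤ n := n.cast_nonneg
          linarith
        refine ⟨i, ?_, hsT _ his, (le_max_right _ _).trans_lt (hk.trans_le hki)⟩
        by_contra hlt
        have := hK ⟨i, not_le.1 hlt, rfl⟩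
        have := le_max_left K M
        linarith
    · intro x hx M
      obtain ⟨k, hk⟩ := exists_nat_gt M
      obtain ⟨m, hm⟩ := hpn k x (lim_mono (hTp k) hx) M
      refine ⟨m, fun i hi hiT => ?_⟩
      obtain ⟨j, hj, hij⟩ := hTlarge k _ hiT
      rw [hc j _ hij]
      rcases hnew rfl k j hj _ hij.1 with h1 | h1
      · rw [h1]
        exact hm i hi (hTp k hiT)
      · have : (0 : ℝ) ≤ n := n.cast_nonneg
        linarith
    · intro ν hν N
      obtain ⟨j, hj, η, hη, hlt⟩ := hcone (Or.inl rfl) N ν hν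
      have hηs := h.antichain_subset_settled (j + 1) hη
      refine ⟨η, hsT _ hηs, hlt, ?_⟩
      rw [hc _ _ hηs]
      have := hlarge j (Or.inr rfl) _ hη
      have : (0 : ℝ) ≤ n := n.cast_nonneg
      have : (N : ℝ) ≤ j := by exact_mod_cast hj
      linarith
    · intro ν hν N
      obtain ⟨j, hj, η, hη, hlt⟩ := hcone (Or.inr rfl) N ν hν
      refine ⟨η, hsT _ (h.antichain_subset_settled (j + 1) hη), hlt, fun ρ hρ hηρ => ?_⟩
      obtain ⟨i, hi, hρi⟩ := hTlarge (j + 1) ρ hρ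
      rw [hc _ _ hρi]
      have := hall rfl j i hi η ρ hη hρi.1 hηρ.1
      have : (0 : ℝ) ≤ n := n.cast_nonneg
      have : (N : ℝ) ≤ j := by exact_mod_cast hj
      linarith
  obtain ⟨q, hqT, hqc⟩ := exists_of_pass (C := C) (e := e) (T := T) (c := c) (r := r)
    ⟨hrT, fun ν hν => hr.2 ν (hTp 0 hν)⟩
    (fun ν _ => by
      simp only [c]
      split_ifs <;> exact cr_mem_K _ _)
    (fun ν hν => by
      obtain ⟨k, hk⟩ := Set.mem_iUnion.1 hν
      rw [hc k ν hk]
      exact (p k).cr_creature hk.1)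
    (fun ν hν => by
      obtain ⟨k, hk⟩ := Set.mem_iUnion.1 hν
      rw [hc k ν hk]
      exact (h.pos_subset_settled hk).trans (hsT _))
    (fun ν hν ρ hρ hlt => by
      obtain ⟨k, hk⟩ := Set.mem_iUnion.1 hν
      rw [hc k ν hk]
      exact (p k).exists_pos_isPrefix hk.1 (hTp k hρ) hlt)
    hnorm
  refine ⟨q, fun k => le_iff.2 ⟨hqT ▸ hTp k, fun ν hν => ?_⟩, fun k ν hν =>
    ⟨hqT ▸ hsT k hν, (hqc ν (hsT k hν)).trans (hc k ν hν)⟩, fun ν hν =>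
    Set.mem_iUnion.1 (hqT ▸ hν : ν ∈ T)⟩
  rw [hqT] at hν
  obtain ⟨j, hj, hνj⟩ := hTlarge k ν hν
  rw [hqc ν hν, hc j ν hνj]
  exact (le_iff.1 (h.le hj)).2 ν hνj.1

end IsFusion

/-- The fusion lemma. -/
theorem exists_fusion {𝓑 : QTree C e → Set (Set (List α))} (h𝓑 : IsTestFamily 𝓑)
    {𝒮 : ℕ → Set (QTree C e)} {n : ℕ} (hd : ∀ k : ℕ, IsDenseAlong 𝓑 ((k : ℝ) + n) (𝒮 k) (𝒮 (k + 1)))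
    {p : QTree C e} {A : Set (List α)} (hA : IsFusionState 𝓑 (𝒮 0) p A) :
    ∃ q, p ≤ q ∧
      (∀ ν ∈ p.T, (∀ η ∈ A, ¬ ProperPrefix η ν) → ν ∈ q.T ∧ q.cr ν = p.cr ν) ∧
      (e = 1 → ∀ ν ∈ q.T, q.cr ν = p.cr ν ∨ (n : ℝ) ≤ (q.cr ν).nor) ∧
      ∀ k, ∀ B ∈ 𝓑 q, ∃ μ ∈ B, ∃ hμ : μ ∈ q.T, ∃ p' ∈ 𝒮 k, p' ≤ q.restr μ hμ := by
  obtain ⟨f, hf0, hf⟩ := exists_sequence_of_step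
    (fun k (s : QTree C e × Set (List α)) => IsFusionState 𝓑 (𝒮 k) s.1 s.2)
    (fun (k : ℕ) s s' => IsFusionStep ((k : ℝ) + n) s.1 s.2 s'.1 s'.2) (s := (p, A)) hA
    (fun k s hs => by
      obtain ⟨q, A', h1, h2⟩ := exists_fusionStep h𝓑 (hd k) hs
      exact ⟨(q, A'), h1, h2⟩)
  have h : IsFusion 𝓑 𝒮 n (fun k => (f k).1) (fun k => (f k).2) :=
    ⟨fun k => (hf k).1, fun k => (hf k).2⟩
  obtain ⟨q, hle, hq, hqs⟩ := h.exists_limit h𝓑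
  obtain rfl : p = (f 0).1 := by rw [hf0]
  obtain rfl : A = (f 0).2 := by rw [hf0]
  refine ⟨q, hle 0, fun ν hν hνA => hq 0 ν ⟨hν, fun η hη hην => ?_⟩, fun he ν hν => ?_,
    fun k B hB => ?_⟩
  · obtain ⟨η', hη', hlt⟩ := (h.step 0).above η hη
    exact hνA η' hη' (hlt.trans_isPrefix hην)
  · obtain ⟨k, hk⟩ := hqs ν hν
    rw [(hq k ν hk).2]
    simpa using h.new he (Nat.zero_le k) hk.1
  · obtain ⟨ν, hν, μ, hμ, hνμ⟩ := (h.state k).hits B (h𝓑.mono _ _ (hle k) hB)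
    obtain ⟨hνp, hν𝒮⟩ := (h.state k).mem ν hν
    have hμq := h𝓑.subset q B hB hμ
    exact ⟨μ, hμ, hμq, _, hν𝒮, restr_le_restr (hle k) hνp hμq hνμ⟩

end QTree

end TreeCreature

namespace TreeCreature

open Forcing

variable {α D : Type u} {H : ℕ → Set α} {C : TreeCreatingPair H D} {e : Fin 4}

namespace QTree

/-! ### Nodes of large norm -/

/-- Otherwise the nodes of `S` with norm below `M` are cofinal among themselves and give a branch
along which the norms do not diverge. -/
theorem exists_cofinal_nor_ge (p : QTree C 1) {S : Set (List α)} (hSp : S ⊆ p.T)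
    (hS : S.Nonempty) (M : ℝ) : ∃ ν ∈ S, ∀ ρ ∈ S, ProperPrefix ν ρ → M ≤ (p.cr ρ).nor := by
  by_contra! hcon
  obtain ⟨ν, hν⟩ := hS
  obtain ⟨η, hη, -, hηM⟩ := hcon ν hν
  obtain ⟨x, hx, hxS⟩ := p.exists_branch (S := {ρ ∈ S | (p.cr ρ).nor < M}) (η := η) ⟨hη, hηM⟩
    (fun ρ hρ => by
      obtain ⟨μ, hμ, hlt, hM⟩ := hcon ρ hρ.1
      exact ⟨μ, ⟨hμ, hM⟩, hlt⟩) (fun ρ hρ => hSp hρ.1)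
  obtain ⟨m, hm⟩ := p.totalNormCond x hx M
  obtain ⟨k, hk, hkS⟩ := hxS m
  exact lt_asymm (hm k hk (hSp hkS.1)) hkS.2

theorem T_nonempty (p : QTree C e) : p.T.Nonempty := p.quasi.imp fun _ h => h.1

theorem lim_nonempty (p : QTree C e) : (lim p.T).Nonempty := by
  obtain ⟨r, hr⟩ := p.T_nonempty
  obtain ⟨x, hx, -⟩ := p.exists_branch hr (fun _ hν => p.exists_properPrefix hν) subset_rfl
  exact ⟨x, hx⟩

theorem exists_initSeg_nor_gt (he : e = 0 ∨ e = 1) (p : QTree C e) {x : ℕ → α} (hx : x ∈ lim p.T)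
    (M : ℝ) : ∃ k, initSeg x k ∈ p.T ∧ M < (p.cr (initSeg x k)).nor := by
  have hp := p.totalNormCond
  rcases he with rfl | rfl
  · obtain ⟨k, -, h⟩ := hp x hx M 0
    exact ⟨k, h⟩
  · obtain ⟨m, hm⟩ := hp x hx M
    obtain ⟨k, hk, hkT⟩ := hx m
    exact ⟨k, hkT, hm k hk.le hkT⟩

theorem exists_nor_ge (he : e = 0 ∨ e = 2) (p : QTree C e) (M : ℝ) :
    ∃ ν ∈ p.T, M ≤ (p.cr ν).nor := by
  rcases he with rfl | rfl
  · obtain ⟨x, hx⟩ := p.lim_nonempty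
    obtain ⟨k, hk, hM⟩ := p.exists_initSeg_nor_gt (Or.inl rfl) hx M
    exact ⟨_, hk, hM.le⟩
  · obtain ⟨r, hr⟩ := p.T_nonempty
    obtain ⟨N, hN⟩ := exists_nat_ge M
    obtain ⟨ν, hν, -, h⟩ := p.totalNormCond r hr N
    exact ⟨ν, hν, hN.trans h⟩

theorem exists_cone_nor_ge (he : e = 1 ∨ e = 3) (p : QTree C e) (M : ℝ) :
    ∃ ν ∈ p.T, ∀ ρ ∈ p.T, ν <+: ρ → M ≤ (p.cr ρ).nor := by
  have key : ∃ ν ∈ p.T, ∀ ρ ∈ p.T, ProperPrefix ν ρ → M ≤ (p.cr ρ).nor := by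
    rcases he with rfl | rfl
    · exact p.exists_cofinal_nor_ge subset_rfl p.T_nonempty M
    · obtain ⟨r, hr⟩ := p.T_nonempty
      obtain ⟨N, hN⟩ := exists_nat_ge M
      obtain ⟨ν, hν, -, h⟩ := p.totalNormCond r hr N
      exact ⟨ν, hν, fun ρ hρ hlt => hN.trans (h ρ hρ hlt)⟩
  obtain ⟨ν, hν, h⟩ := key
  obtain ⟨μ, hμ, hlt⟩ := p.exists_properPrefix hν
  exact ⟨μ, hμ, fun ρ hρ hμρ => h ρ hρ (hlt.trans_isPrefix hμρ)⟩

/-- For `e = 0, 2` only the root needs a large norm; for `e = 1, 3` there is a cone with large norms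
throughout, so the comparison with `q` plays no role. -/
theorem exists_isLarge_restr (p : QTree C e) (M : ℝ) :
    ∃ ν, ∃ h : ν ∈ p.T, ∀ q : QTree C e, IsLarge M q (p.restr ν h) := by
  by_cases he : e = 0 ∨ e = 2
  · obtain ⟨ν, h, hM⟩ := p.exists_nor_ge he M
    refine ⟨ν, h, fun q => ⟨fun _ ρ hρ => ?_, ?_, ?_⟩⟩
    · rw [p.restr_cr hρ.1, hρ.unique (p.isRoot_restr h)]
      exact hM
    · rintro rfl
      simp at he
    · rintro rfl
      simp at he
  · have he' : e = 1 ∨ e = 3 := by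
      revert he
      fin_cases e <;> simp
    obtain ⟨ν, h, hM⟩ := p.exists_cone_nor_ge he' M
    have hall : ∀ ρ ∈ (p.restr ν h).T, M ≤ ((p.restr ν h).cr ρ).nor := fun ρ hρ => by
      rw [p.restr_cr hρ]
      exact hM ρ hρ.1 hρ.2
    exact ⟨ν, h, fun q => ⟨fun h' => (he h').elim, fun _ ρ hρ => Or.inr (hall ρ hρ),
      fun _ => hall⟩⟩

/-! ### Test families -/

/-- The trees of the conditions stronger than `p`. -/
def thickTests (p : QTree C e) : Set (Set (List α)) := {B | ∃ r : QTree C e, p ≤ r ∧ B = r.T}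

/-- The infinite subsets of the branches of `p`. -/
def branchTests (p : QTree C e) : Set (Set (List α)) :=
  {B | B ⊆ p.T ∧ ∃ x : ℕ → α, (∀ ν ∈ B, ∃ k, ν = initSeg x k) ∧
    ∀ m, ∃ k, m < k ∧ initSeg x k ∈ B}

theorem isTestFamily_thickTests : IsTestFamily (thickTests (C := C) (e := e)) where
  subset := by
    rintro p _ ⟨r, hr, rfl⟩
    exact T_subset hr
  nonempty := by
    rintro p _ ⟨r, hr, rfl⟩
    exact r.T_nonempty
  mono := by
    rintro p q hpq _ ⟨r, hr, rfl⟩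
    exact ⟨r, le_trans hpq hr, rfl⟩
  restr := by
    rintro p _ ⟨r, hr, rfl⟩ ν ⟨μ, hμ, hνμ⟩ h
    obtain ⟨ρ, hρ, hlt⟩ := r.exists_properPrefix hμ
    have hνρ := hνμ.trans_properPrefix hlt
    exact ⟨_, ⟨r.restr ρ hρ, restr_le_restr hr h hρ hνρ.1, rfl⟩, fun _ hσ => hσ.1,
      fun σ hσ => hνρ.trans_isPrefix hσ.2⟩
  cone := fun _ p η h => ⟨_, p.le_restr h, rfl⟩

/-- Infinite subsets of branches are used instead of full branches so that a test can be cut off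
above any of its nodes and is still a test of each weaker condition. -/
theorem isTestFamily_branchTests (he : e = 0 ∨ e = 1) :
    IsTestFamily (branchTests (C := C) (e := e)) where
  subset := fun _ _ h => h.1
  nonempty := by
    rintro p B ⟨-, x, -, h⟩
    obtain ⟨k, -, hk⟩ := h 0
    exact ⟨_, hk⟩
  mono := fun p q hpq B hB => ⟨hB.1.trans (T_subset hpq), hB.2⟩
  restr := by
    rintro p B ⟨hBp, x, hx, hinf⟩ ν ⟨μ, hμ, hνμ⟩ h
    obtain ⟨k, rfl⟩ := hx μ hμ
    have hν := eq_initSeg_of_isPrefix hνμ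
    refine ⟨{ρ ∈ B | ProperPrefix ν ρ}, ⟨fun ρ hρ => ⟨hBp hρ.1, hρ.2.1⟩, x, fun ρ hρ => hx ρ hρ.1,
      fun m => ?_⟩, fun ρ hρ => hρ.1, fun ρ hρ => hρ.2⟩
    obtain ⟨i, hi, hiB⟩ := hinf (max m ν.length)
    refine ⟨i, (_root_.le_max_left _ _).trans_lt hi, hiB, ?_⟩
    rw [hν]
    exact initSeg_properPrefix_iff.2 ((_root_.le_max_right _ _).trans_lt hi)
  cone := fun he' => by
    rcases he with rfl | rfl <;> simp at he'

/-! ### The nodes `F⁰_n(p)` and the relations `≤ᵉ_n` -/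

theorem mem_firstNodes {p : QTree C e} {n : ℕ} {η : List α} :
    η ∈ p.firstNodes n ↔ η ∈ p.T ∧ (n : ℝ) < (p.cr η).nor ∧
      ∀ ν ∈ p.T, ProperPrefix ν η → (p.cr ν).nor ≤ n := by
  constructor
  · rintro ⟨h, h1, h2⟩
    refine ⟨h, p.cr_of_mem h ▸ h1, fun ν hν hlt => ?_⟩
    rw [p.cr_of_mem hν]
    exact h2 ⟨ν, hν⟩ hlt
  · rintro ⟨h, h1, h2⟩
    refine ⟨h, p.cr_of_mem h ▸ h1, fun ν hlt => ?_⟩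
    rw [← p.cr_coe]
    exact h2 ν ν.2 hlt

theorem isPrefixAntichain_firstNodes (p : QTree C e) (n : ℕ) :
    IsPrefixAntichain (p.firstNodes n) := by
  intro η hη ν hν hlt
  rw [mem_firstNodes] at hη hν
  exact absurd (hν.2.2 η hη.1 hlt) (not_le.2 hη.2.1)

theorem exists_firstNodes_isPrefix (p : QTree C e) {n : ℕ} {ν : List α} (hν : ν ∈ p.T)
    (h : (n : ℝ) < (p.cr ν).nor) : ∃ η ∈ p.firstNodes n, η <+: ν := by
  obtain ⟨η, hη, hle⟩ := exists_minPts_isPrefix (Z := {ρ ∈ p.T | (n : ℝ) < (p.cr ρ).nor}) ⟨hν, h⟩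
  exact ⟨η, mem_firstNodes.2 ⟨hη.1.1, hη.1.2, fun ρ hρ hlt => not_lt.1 fun h' =>
    hη.2 ρ ⟨hρ, h'⟩ hlt⟩, hle⟩

theorem firstNodes_meets_branchTests (he : e = 0 ∨ e = 1) (p : QTree C e) (n : ℕ)
    {B : Set (List α)} (hB : B ∈ p.branchTests) : (p.firstNodes n ∩ dcl B).Nonempty := by
  obtain ⟨hBp, x, hx, hinf⟩ := hB
  obtain ⟨k, hk, hn⟩ := p.exists_initSeg_nor_gt he
    (fun m => (hinf m).imp fun i hi => ⟨hi.1, hBp hi.2⟩) n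
  obtain ⟨η, hη, hle⟩ := p.exists_firstNodes_isPrefix hk hn
  obtain ⟨i, hi, hiB⟩ := hinf k
  exact ⟨η, hη, _, hiB, hle.trans (initSeg_prefix_of_le x hi.le)⟩

/-- For `e = 2`, a creature of `r` of norm at least `n + 1` arises from creatures of `p`. By
boundedness one of these, at an initial segment of a possibility in `r.T`, has norm above `n`. In
the other cases a branch of `r` is a branch of `p`, where norms are unbounded. -/
theorem firstNodes_meets_thickTests (he : e < 3) (hb : e = 2 → C.IsBounded) (p : QTree C e) (n : ℕ)
    {B : Set (List α)} (hB : B ∈ p.thickTests) : (p.firstNodes n ∩ dcl B).Nonempty := by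
  obtain ⟨r, hr, rfl⟩ := hB
  by_cases he2 : e = 2
  · obtain ⟨ν, hν, hn⟩ := r.exists_nor_ge (Or.inr he2) (n + 1)
    obtain ⟨T, s, hs, hTp, hS, hsp⟩ := p.exists_system_of_mem_gens ((le_iff.1 hr).2 ν hν)
    obtain ⟨ρ, η, hη, hρη, hρn⟩ : ∃ ρ : hat T, ∃ η ∈ (r.cr ν).pos, ProperPrefix ρ η ∧
        (n : ℝ) < (s ρ).nor := by
      by_contra! hcon
      have := hb he2 T s hs _ hS n fun ρ ⟨η, hη, h⟩ => hcon ρ η hη h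
      linarith
    rw [hsp] at hρn
    obtain ⟨μ, hμ, hle⟩ := p.exists_firstNodes_isPrefix (hTp ρ.2.1) hρn
    exact ⟨μ, hμ, η, r.pos_cr_subset hν hη, hle.trans hρη.1⟩
  · have he' : e = 0 ∨ e = 1 := by
      revert he he2
      fin_cases e <;> simp
    obtain ⟨x, hx⟩ := r.lim_nonempty
    obtain ⟨k, hk, hn⟩ := p.exists_initSeg_nor_gt he' (lim_mono (T_subset hr) hx) n
    obtain ⟨η, hη, hle⟩ := p.exists_firstNodes_isPrefix hk hn
    obtain ⟨i, hi, hiT⟩ := hx k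
    exact ⟨η, hη, _, hiT, hle.trans (initSeg_prefix_of_le x hi.le)⟩

theorem isFusionState_root {𝓑 : QTree C e → Set (Set (List α))} (h𝓑 : IsTestFamily 𝓑)
    {𝒮 : Set (QTree C e)} {p : QTree C e} (hp : p ∈ 𝒮) {r : List α} (hr : IsRoot p.T r) :
    IsFusionState 𝓑 𝒮 p {r} where
  subset := by simpa using hr.1
  antichain := isPrefixAntichain_singleton r
  hits := fun B hB => by
    obtain ⟨μ, hμ⟩ := h𝓑.nonempty p B hB
    exact ⟨r, rfl, μ, hμ, hr.2 μ (h𝓑.subset p B hB hμ)⟩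
  mem := by
    rintro _ rfl
    exact ⟨hr.1, (p.restr_root hr).symm ▸ hp⟩

/-- Fusion below `p` with respect to `≤ᵉ_n`. -/
theorem exists_LEn_fusion {𝓑 : QTree C e → Set (Set (List α))} (h𝓑 : IsTestFamily 𝓑)
    (p : QTree C e) (n : ℕ)
    (hF : ∀ m, ∀ B ∈ 𝓑 p, (p.firstNodes m ∩ dcl B).Nonempty)
    (𝒮 : ℕ → Set (QTree C e)) (hd : ∀ M k, IsDenseAlong 𝓑 M Set.univ (𝒮 k)) :
    ∃ q, LEn n p q ∧
      ∀ k, ∀ B ∈ 𝓑 q, ∃ μ ∈ B, ∃ hμ : μ ∈ q.T, ∃ p' ∈ 𝒮 k, p' ≤ q.restr μ hμ := by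
  obtain ⟨r, hr⟩ := p.quasi
  -- Starting at `F⁰_m(p)` protects exactly the nodes that `≤ᵉ_{m+1}` keeps fixed. For `n = 0` only
  -- the root must stay.
  have hstart : ∃ A, IsFusionState 𝓑 Set.univ p A ∧ ∀ m, n = m + 1 → A = p.firstNodes m := by
    cases n with
    | zero => exact ⟨{r}, isFusionState_root h𝓑 (Set.mem_univ _) hr, fun m hm => by simp at hm⟩
    | succ m =>
      refine ⟨p.firstNodes m, ⟨fun η hη => (mem_firstNodes.1 hη).1, p.isPrefixAntichain_firstNodes m,
        hF m, fun η hη => ⟨(mem_firstNodes.1 hη).1, Set.mem_univ _⟩⟩, ?_⟩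
      rintro _ ⟨⟩
      rfl
  obtain ⟨A, hA, hAn⟩ := hstart
  obtain ⟨q, hpq, hkeep, hnew, hq⟩ := exists_fusion h𝓑 (n := n)
    -- The index is shifted by one: no demand is made on the cones of the initial antichain.
    (𝒮 := fun k => {p | ∀ j, k = j + 1 → p ∈ 𝒮 j})
    (fun k p _ B hB => by
      obtain ⟨μ, hμ, q, hq, h⟩ := hd (k + n) k p (Set.mem_univ _) B hB
      refine ⟨μ, hμ, q, ?_, h⟩
      rintro _ ⟨⟩
      exact hq)
    (p := p) (A := A) ⟨hA.subset, hA.antichain, hA.hits, fun ν hν => by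
      obtain ⟨h, -⟩ := hA.mem ν hν
      exact ⟨h, fun j hj => by simp at hj⟩⟩
  have hrq : r ∈ q.T := (hkeep r hr.1 fun η hη hlt => hlt.not_isPrefix (hr.2 η (hA.subset hη))).1
  refine ⟨q, ⟨⟨hpq, r, hr, hrq, fun ν hν => hr.2 ν (T_subset hpq hν)⟩, ?_⟩, fun k B hB => ?_⟩
  · cases n with
    | zero => trivial
    | succ m =>
      obtain rfl := hAn m rfl
      refine ⟨fun η hη ν hνη => ?_, ?_⟩
      · obtain ⟨h1, h2⟩ := hkeep ν ν.2 fun η' hη' hlt =>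
          hA.antichain η' hη' η hη (hlt.trans_isPrefix hνη)
        exact ⟨h1, by rw [← q.cr_of_mem h1, h2, p.cr_coe]⟩
      · rintro he c ⟨⟨η, rfl⟩, hc⟩
        rw [← q.cr_coe] at hc ⊢
        rcases hnew he η η.2 with h | h
        · exact ⟨⟨η, T_subset hpq η.2⟩, by rw [h, ← p.cr_coe]⟩
        -- A changed creature has norm at least `m + 1`, so it is not among those of norm at most
        -- `m`.
        · push_cast at h
          linarith
  · obtain ⟨μ, hμ, hμq, p', hp', hle⟩ := hq (k + 1) B hB
    exact ⟨μ, hμ, hμq, p', hp' k rfl, hle⟩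

/-! ### Antichains deciding names -/

/-- Take recursively the minimal deciding nodes properly above the previous antichain. They meet a
test because its part above a point of the previous antichain contains a test again. -/
theorem exists_decidesAlong {𝓑 : QTree C e → Set (Set (List α))} (h𝓑 : IsTestFamily 𝓑)
    (q : QTree C e) (τ : ℕ → PName (QTree C e))
    (hq : ∀ k, ∀ B ∈ 𝓑 q, ∃ μ ∈ B, ∃ hμ : μ ∈ q.T, Decides (q.restr μ hμ) (τ k)) :
    ∃ A : ℕ → Set (List α), (∀ k, A k ⊆ q.T ∧ IsPrefixAntichain (A k) ∧
      ∀ B ∈ 𝓑 q, (A k ∩ dcl B).Nonempty) ∧ q.DecidesAlong τ A := by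
  let Y : ℕ → Set (List α) := fun k => {μ | ∃ hμ : μ ∈ q.T, Decides (q.restr μ hμ) (τ k)}
  let A : ℕ → Set (List α) := fun k => Nat.rec (minPts (Y 0))
    (fun k S => minPts {μ ∈ Y (k + 1) | ∃ η ∈ S, ProperPrefix η μ}) k
  have hAY : ∀ k, A k ⊆ Y k := by
    intro k
    cases k with
    | zero => exact minPts_subset _
    | succ k => exact fun μ hμ => hμ.1.1
  refine ⟨A, fun k => ⟨fun μ hμ => (hAY k hμ).1, ?_, ?_⟩, fun k =>
    ⟨fun η h hη => (hAY k hη).2, fun ν hν => hν.1.2⟩⟩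
  · cases k <;> exact isPrefixAntichain_minPts _
  · induction k with
    | zero =>
      intro B hB
      obtain ⟨μ, hμ, hY⟩ := hq 0 B hB
      obtain ⟨ν, hν, hle⟩ := exists_minPts_isPrefix (Z := Y 0) hY
      exact ⟨ν, hν, μ, hμ, hle⟩
    | succ k ih =>
      intro B hB
      obtain ⟨η, hη, hηB⟩ := ih B hB
      obtain ⟨B', hB', hsub, hlt⟩ := h𝓑.restr q B hB η hηB (hAY k hη).1
      obtain ⟨μ, hμ, hY⟩ := hq (k + 1) B' (h𝓑.mono _ _ (q.le_restr _) hB')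
      obtain ⟨ν, hν, hle⟩ := exists_minPts_isPrefix
        (Z := {μ ∈ Y (k + 1) | ∃ η ∈ A k, ProperPrefix η μ}) ⟨hY, η, hη, hlt μ hμ⟩
      exact ⟨ν, hν, μ, hsub hμ, hle⟩

theorem isDenseAlong_decides {τ : PName (QTree C e)} (hτ : IsOrdinalName τ) (M : ℝ) :
    IsDenseAlong thickTests M Set.univ {p : QTree C e | Decides p τ} := by
  rintro p - _ ⟨r, hr, rfl⟩
  obtain ⟨q, hrq, hq⟩ := hτ r
  obtain ⟨ν, hν, hl⟩ := q.exists_isLarge_restr M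
  exact ⟨ν, T_subset hrq hν, q.restr ν hν, decides_mono (q.le_restr hν) hq, q.isRoot_restr hν,
    le_trans hr (le_trans hrq (q.le_restr hν)), hl p⟩

theorem exists_thickAntichains (q : QTree C e) (τ : ℕ → PName (QTree C e))
    (hq : ∀ k, ∀ B ∈ q.thickTests, ∃ μ ∈ B, ∃ hμ : μ ∈ q.T,
      ∃ p ∈ {p : QTree C e | Decides p (τ k)}, p ≤ q.restr μ hμ) :
    ∃ A : ℕ → Set (List α), (∀ k, q.IsThickAntichain (A k)) ∧ q.DecidesAlong τ A := by
  obtain ⟨A, hA, h⟩ := exists_decidesAlong isTestFamily_thickTests q τ fun k B hB => by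
    obtain ⟨μ, hμ, hμq, p, hp, hle⟩ := hq k B hB
    exact ⟨μ, hμ, hμq, decides_mono hle hp⟩
  exact ⟨A, fun k => ⟨(hA k).1, (hA k).2.1, fun r hr => (hA k).2.2 _ ⟨r, hr, rfl⟩⟩, h⟩

theorem exists_LEn_thickAntichains (he : e < 3) (hb : e = 2 → C.IsBounded) (p : QTree C e) (n : ℕ)
    (τ : ℕ → PName (QTree C e)) (hτ : ∀ k, IsOrdinalName (τ k)) :
    ∃ (q : QTree C e) (A : ℕ → Set (List α)), (∀ k, q.IsThickAntichain (A k)) ∧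
      LEn n p q ∧ q.DecidesAlong τ A := by
  obtain ⟨q, hpq, hq⟩ := exists_LEn_fusion isTestFamily_thickTests p n
    (fun m B hB => p.firstNodes_meets_thickTests he hb m hB) (fun k => {p | Decides p (τ k)})
    fun M k => isDenseAlong_decides (hτ k) M
  obtain ⟨A, hA, h⟩ := exists_thickAntichains q τ hq
  exact ⟨q, A, hA, hpq, h⟩

theorem exists_le_thickAntichains (p : QTree C e) (τ : ℕ → PName (QTree C e))
    (hτ : ∀ k, IsOrdinalName (τ k)) :
    ∃ (q : QTree C e) (A : ℕ → Set (List α)), (∀ k, q.IsThickAntichain (A k)) ∧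
      p ≤ q ∧ q.DecidesAlong τ A := by
  obtain ⟨r, hr⟩ := p.quasi
  obtain ⟨q, hpq, -, -, hq⟩ := exists_fusion isTestFamily_thickTests (n := 0) (p := p) (A := {r})
    (𝒮 := fun k => {p | ∀ j, k = j + 1 → Decides p (τ j)})
    (fun k p _ B hB => by
      obtain ⟨μ, hμ, q, hq, h⟩ := isDenseAlong_decides (hτ k) _ p (Set.mem_univ _) B hB
      refine ⟨μ, hμ, q, ?_, h⟩
      rintro _ ⟨⟩
      exact hq)
    (isFusionState_root isTestFamily_thickTests (fun j hj => by simp at hj) hr)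
  obtain ⟨A, hA, h⟩ := exists_thickAntichains q τ fun k B hB => by
    obtain ⟨μ, hμ, hμq, p', hp', hle⟩ := hq (k + 1) B hB
    exact ⟨μ, hμ, hμq, p', hp' k rfl, hle⟩
  exact ⟨q, A, hA, hpq, h⟩

end QTree

end TreeCreature

namespace TreeCreature

open Forcing

variable {α D : Type u} {H : ℕ → Set α} {C : TreeCreatingPair H D} {e : Fin 4}

namespace QTree

/-! ### Deciding names along fronts -/

/-- The value of `τ` is decided along each branch of `p`. -/
def DecidesOnBranches (p : QTree C e) (τ : PName (QTree C e)) : Prop :=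
  ∀ x ∈ lim p.T, ∃ m, ∃ h : initSeg x m ∈ p.T, Decides (p.restr _ h) τ

theorem DecidesOnBranches.of_decides {p : QTree C e} {τ : PName (QTree C e)} (h : Decides p τ) :
    DecidesOnBranches p τ := fun x hx => by
  obtain ⟨m, -, hm⟩ := hx 0
  exact ⟨m, hm, decides_mono (p.le_restr hm) h⟩

/-- A branch of `q` through the given node is also a branch of `p`; beyond the point where `p`
decides along it, cones of `q` are stronger than the deciding cone of `p`. -/
theorem DecidesOnBranches.exists_of_le {p q : QTree C e} {τ : PName (QTree C e)}
    (h : DecidesOnBranches p τ) {x : ℕ → α} {k : ℕ} (hx : x ∈ lim q.T) (hk : initSeg x k ∈ q.T)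
    (hle : p ≤ q.restr _ hk) : ∃ m, ∀ i, m ≤ i → ∀ hi : initSeg x i ∈ q.T,
      Decides (q.restr _ hi) τ := by
  have hxp : x ∈ lim p.T := by
    intro m
    obtain ⟨i, hi, hiT⟩ := hx (max m k)
    exact ⟨i, (_root_.le_max_left _ _).trans_lt hi, T_subset hle ⟨hiT,
      initSeg_prefix_of_le x ((_root_.le_max_right _ _).trans hi.le)⟩⟩
  obtain ⟨m, hm, hd⟩ := h x hxp
  refine ⟨max m k, fun i hi hiT => ?_⟩
  have hki := initSeg_prefix_of_le x ((_root_.le_max_right m k).trans hi)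
  have hmi := initSeg_prefix_of_le x ((_root_.le_max_left m k).trans hi)
  have hpq : p ≤ q.restr _ hiT := le_trans hle (restr_le_restr (le_refl q) hk hiT hki)
  exact decides_mono (restr_le hpq hm fun ν hν => hmi.trans hν.2) hd

/-- The finite system of the creatures of `p` at the initial segments of `ν`. -/
theorem exists_system_below (p : QTree C e) {r ν : List α} (hr : IsRoot p.T r) (hν : ν ∈ p.T) :
    ∃ (T : Set (List α)) (s : hat T → WeakCreature H D), IsSystem T s ∧ (hat T).Countable ∧
      hat T ⊆ p.T ∧ (∀ ρ : hat T, s ρ = p.cr ρ) ∧ IsRoot T r ∧ ν ∈ hat T ∧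
      (p.cr ν).pos ⊆ maxPts T := by
  let T : Set (List α) := {ρ | ρ ∈ p.T ∧ (ρ <+: ν ∨ ∃ σ ∈ p.T, σ <+: ν ∧ ρ ∈ succs p.T σ)}
  have hmem : ∀ σ ∈ p.T, σ <+: ν → succs p.T σ ⊆ T := fun σ hσ hσν ρ hρ =>
    ⟨hρ.1, Or.inr ⟨σ, hσ, hσν, hρ⟩⟩
  have hmax : ∀ ρ ∈ T, ¬ ρ <+: ν → ρ ∈ maxPts T := by
    rintro ρ hρ hρν
    refine ⟨hρ, ?_⟩
    rintro ⟨σ, ⟨-, hσν | ⟨σ', hσ', hσ'ν, hσ⟩⟩, hlt⟩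
    · exact hρν (hlt.1.trans hσν)
    · rcases prefix_or_properPrefix hlt.1 hσ.2.1.1 with h | h
      · exact hρν (h.trans hσ'ν)
      · exact hσ.2.2 ⟨ρ, hρ.1, h, hlt⟩
  have hhat : ∀ ρ, ρ ∈ hat T ↔ ρ ∈ p.T ∧ ρ <+: ν := by
    intro ρ
    constructor
    · exact fun h => ⟨h.1.1, by_contra fun h' => h.2 (hmax ρ h.1 h')⟩
    · rintro ⟨hρ, hρν⟩
      refine ⟨⟨hρ, Or.inl hρν⟩, fun h => ?_⟩
      obtain ⟨μ, hμ⟩ := (p.cr ρ).pos_nonempty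
      rw [p.cr_pos hρ] at hμ
      exact h.2 ⟨μ, hmem ρ hρ hρν hμ, hμ.2.1⟩
  have hsucc : ∀ ρ ∈ hat T, succs T ρ = succs p.T ρ := by
    intro ρ hρ
    obtain ⟨hρp, hρν⟩ := (hhat ρ).1 hρ
    ext μ
    constructor
    · rintro ⟨hμ, hlt, hmin⟩
      obtain ⟨σ, hσ, hσμ⟩ := exists_succ_isPrefix hμ.1 hlt
      by_cases heq : σ = μ
      · exact heq ▸ hσ
      · exact (hmin ⟨σ, hmem ρ hρp hρν hσ, hσ.2.1, hσμ, heq⟩).elim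
    · intro hμ
      exact ⟨hmem ρ hρp hρν hμ, hμ.2.1, fun ⟨σ, hσ, h⟩ => hμ.2.2 ⟨σ, hσ.1, h⟩⟩
  have hroot : IsRoot T r := ⟨⟨hr.1, Or.inl (hr.2 ν hν)⟩, fun ρ hρ => hr.2 ρ hρ.1⟩
  refine ⟨T, fun ρ => p.cr ρ, ⟨⟨r, hroot⟩, ?_, fun ρ hρ => p.seqs hρ.1,
    fun ρ => p.cr_creature ρ.2.1.1, fun ρ => ?_⟩, ?_, fun ρ hρ => hρ.1.1, fun _ => rfl, hroot,
    (hhat ν).2 ⟨hν, List.prefix_rfl⟩, ?_⟩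
  · refine Set.eq_empty_of_forall_notMem fun x hx => ?_
    obtain ⟨m, hm, hmT⟩ := hx ν.length
    obtain ⟨k, hk, hkT⟩ := hx m
    refine (hmax _ hmT fun h => ?_).2 ⟨_, hkT, initSeg_properPrefix_iff.2 hk⟩
    have := h.length_le
    rw [length_initSeg] at this
    omega
  · rw [p.cr_pos ρ.2.1.1, hsucc ρ ρ.2]
  · refine ((List.finite_toSet ν.inits).subset fun ρ hρ => ?_).countable
    simpa using ((hhat ρ).1 hρ).2
  · intro μ hμ
    have hlt := (p.cr_creature hν).properPrefix hμ
    rw [p.cr_pos hν] at hμ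
    exact hmax μ (hmem ν hν List.prefix_rfl hμ) hlt.not_isPrefix

/-- Glue a deciding cone into `p` at a node `ν` of large norm. Omitting everything else in the
finite system below `ν` gives a creature at the root whose possibilities all lie above `ν`. Norm `M
+ 1` at `ν` is asked for because omission may lose one. -/
theorem exists_decidesOnBranches_of_isTOmittory (hC : C.IsTOmittory) (p : QTree C 0)
    {τ : PName (QTree C 0)} (hτ : IsOrdinalName τ) (M : ℝ) {r : List α} (hr : IsRoot p.T r) :
    ∃ q, p ≤ q ∧ IsRoot q.T r ∧ DecidesOnBranches q τ ∧ IsLarge M p q := by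
  obtain ⟨p₁, hpp₁, hp₁⟩ := hτ p
  obtain ⟨ν, hν, hνM⟩ := p₁.exists_nor_ge (Or.inl rfl) (M + 1)
  obtain ⟨p₂, hpp₂, hmem₂, -, hres⟩ := p.exists_glue (A := {ν}) (by simpa using T_subset hpp₁ hν)
    (isPrefixAntichain_singleton ν) (fun _ => p₁.restr ν hν)
    (by
      rintro _ rfl
      exact p₁.isRoot_restr hν)
    (fun _ _ => le_trans hpp₁ (p₁.le_restr hν))
  obtain ⟨hν₂, hres⟩ := hres ν rfl
  have hdec : Decides (p₂.restr ν hν₂) τ := hres ▸ decides_mono (p₁.le_restr hν) hp₁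
  have hcr : p₂.cr ν = p₁.cr ν := by
    have h1 := p₂.restr_cr (p₂.isRoot_restr hν₂).1
    rw [hres, p₁.restr_cr (p₁.isRoot_restr hν).1] at h1
    exact h1.symm
  have hr₂ : IsRoot p₂.T r := by
    refine ⟨?_, fun μ hμ => hr.2 μ (T_subset hpp₂ hμ)⟩
    by_cases hνr : ν <+: r
    · exact prefix_antisymm hνr (hr.2 ν (T_subset hpp₂ hν₂)) ▸ hν₂
    · exact hmem₂ r hr.1 (by simpa using hνr)
  obtain ⟨T, s, hs, hcount, hTp, hsp, hrT, hνT, hmax⟩ := p₂.exists_system_below hr₂ hν₂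
  obtain ⟨c, hc, hcM, hcpos⟩ := hC T s hs hcount (fun ρ => hsp ρ ▸ p₂.cr_mem_K ρ) ⟨ν, hνT⟩
    (by rwa [hsp])
  rw [hsp] at hcM hcpos
  obtain ⟨r', hr', hcr'⟩ := (C.result T s hs c hc).1
  obtain rfl := hrT.unique hr'
  have hcg : c ∈ p₂.gens := ⟨hat T, hTp, by
    convert hc using 2
    ext t
    constructor
    · rintro ⟨μ, hμ, rfl⟩
      exact ⟨⟨μ, hμ⟩, hsp _⟩
    · rintro ⟨μ, rfl⟩
      exact ⟨μ, μ.2, (hsp _).symm⟩⟩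
  have hpos : ∀ μ ∈ c.pos, μ ∈ p₂.T ∧ ProperPrefix ν μ := fun μ hμ =>
    ⟨p₂.pos_cr_subset hν₂ (hcpos hμ), (p₂.cr_creature hν₂).properPrefix (hcpos hμ)⟩
  have hf : ∀ μ ∈ c.pos, ∃ f : QTree C 0, IsRoot f.T μ ∧ p₂ ≤ f ∧ Decides f τ := fun μ hμ => by
    obtain ⟨h1, h2⟩ := hpos μ hμ
    exact ⟨p₂.restr μ h1, p₂.isRoot_restr h1, p₂.le_restr h1,
      decides_mono (restr_le_restr (le_refl p₂) hν₂ h1 h2.1) hdec⟩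
  have : Nonempty (QTree C 0) := ⟨p⟩
  choose! f hfr hfle hfd using hf
  obtain ⟨q, hpq, hrq, hqc, hq⟩ := exists_amalgamation (Or.inl rfl) hr₂.1 hcr' hcg f hfr hfle
  refine ⟨q, le_trans hpp₂ hpq, hrq, fun x hx => ?_, ⟨fun _ ρ hρ => ?_, fun h => by simp at h,
    fun h => by simp at h⟩⟩
  · obtain ⟨k, hk, hkT⟩ := hx r.length
    rcases hq _ hkT with h | ⟨μ, hμ, -, hle, -⟩
    · have := congrArg List.length h
      rw [length_initSeg] at this
      omega
    · exact ⟨k, hkT, decides_mono hle (hfd μ hμ)⟩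
  · rw [hρ.unique hrq, hqc]
    rw [hcr] at hcM
    linarith

/-- A node is good if it is the root of a suitable condition, and goodness passes down from all
possibilities of a creature to its node, if the creature is old or of large norm. Colouring
possibilities by goodness, bigness finds a homogeneous creature at a bad node of large norm, and its
colour must be bad. Pruning to such creatures leaves only bad nodes, which a stronger deciding
condition refutes. -/
theorem exists_decidesOnBranches_of_isBig (hC : C.IsBig 2) (p : QTree C 1)
    {τ : PName (QTree C 1)} (hτ : IsOrdinalName τ) (M : ℝ) {r : List α} (hr : IsRoot p.T r) :
    ∃ q, p ≤ q ∧ IsRoot q.T r ∧ DecidesOnBranches q τ ∧ IsLarge M p q := by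
  classical
  let Good : List α → Prop := fun ν =>
    ∃ q, p ≤ q ∧ IsRoot q.T ν ∧ DecidesOnBranches q τ ∧ IsLarge M p q
  have hlarge : ∀ q : QTree C 1, (∀ ν ∈ q.T, q.cr ν = p.cr ν ∨ M ≤ (q.cr ν).nor) → IsLarge M p q :=
    fun q h => ⟨fun h => by simp at h, fun _ => h, fun h => by simp at h⟩
  have hgood : ∀ ν ∈ p.T, ∀ s ∈ p.gens, s.IsTreeCreatureAt ν → (∀ μ ∈ s.pos, Good μ) →
      (s = p.cr ν ∨ M ≤ s.nor) → Good ν := by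
    intro ν hν s hs hsν hpos hsM
    have : Nonempty (QTree C 1) := ⟨p⟩
    choose! f hfle hfr hfd hfl using hpos
    obtain ⟨q, hpq, hrq, hqc, hq⟩ := exists_amalgamation (Or.inr rfl) hν hsν hs f hfr hfle
    refine ⟨q, hpq, hrq, fun x hx => ?_, hlarge q fun ρ hρ => ?_⟩
    · obtain ⟨k, hk, hkT⟩ := hx ν.length
      rcases hq _ hkT with h | ⟨μ, hμ, -, hle, -⟩
      · have := congrArg List.length h
        rw [length_initSeg] at this
        omega
      · obtain ⟨m, hm⟩ := (hfd μ hμ).exists_of_le hx hkT hle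
        obtain ⟨i, hi, hiT⟩ := hx m
        exact ⟨i, hiT, hm i hi.le hiT⟩
    · rcases hq ρ hρ with rfl | ⟨μ, hμ, -, -, h1, h2⟩
      · rwa [hqc]
      · rw [h2]
        exact (hfl μ hμ).new rfl ρ h1
  suffices h : ∀ ν ∈ p.T, Good ν from h r hr.1
  by_contra! hcon
  let S : Set (List α) := {ν ∈ p.T | ¬ Good ν}
  have hsucc : ∀ ν ∈ S, ∃ μ ∈ S, ProperPrefix ν μ := by
    rintro ν ⟨hν, hbad⟩
    by_contra! hcon
    refine hbad (hgood ν hν _ (p.cr_mem_gens hν) (p.cr_creature hν) (fun μ hμ => ?_) (Or.inl rfl))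
    by_contra hμ'
    exact hcon μ ⟨p.pos_cr_subset hν hμ, hμ'⟩ ((p.cr_creature hν).properPrefix hμ)
  -- The bound makes the norms exceed `1`, as bigness requires, and keeps them at least `M` after
  -- the loss of one.
  obtain ⟨ν₀, hν₀, hν₀M⟩ := p.exists_cofinal_nor_ge (S := S) (fun ν h => h.1) hcon (max M 1 + 1)
  obtain ⟨ν, hν, hlt⟩ := hsucc ν₀ hν₀
  have hbig : ∀ ρ ∈ {ρ ∈ S | ProperPrefix ν₀ ρ}, ∃ s ∈ C.Sig {p.cr ρ},
      s.pos ⊆ {ρ ∈ S | ProperPrefix ν₀ ρ} ∧ (p.cr ρ).nor - 1 ≤ s.nor := by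
    rintro ρ ⟨⟨hρ, hbad⟩, hν₀ρ⟩
    have hM := hν₀M ρ ⟨hρ, hbad⟩ hν₀ρ
    have h1 := le_max_left M 1
    have h2 := le_max_right M 1
    obtain ⟨s, hs, ⟨c, hc⟩, hsn⟩ := hC (p.cr ρ) (p.cr_mem_K ρ) (by linarith)
      fun μ => if Good μ then 0 else 1
    have hsg := p.sig_subset_gens hρ hs
    have hsρ := p.isTreeCreatureAt_of_mem_sig hρ hs
    have hspos : s.pos ⊆ p.T := by
      obtain ⟨T, t, ht, hTp, hS, -⟩ := p.exists_system_of_mem_gens hsg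
      exact fun μ hμ => hTp ((C.result T t ht s hS).2 hμ).1
    obtain ⟨μ, hμ, hμg⟩ : ∃ μ ∈ s.pos, ¬ Good μ := by
      by_contra! h
      exact hbad (hgood ρ hρ s hsg hsρ h (Or.inr (by linarith)))
    have hc1 : 1 = c := by simpa [hμg] using hc μ hμ
    refine ⟨s, hs, fun σ hσ => ⟨⟨hspos hσ, fun hσg => ?_⟩,
      hν₀ρ.trans_isPrefix (hsρ.properPrefix hσ).1⟩, hsn⟩
    have := hc σ hσ
    rw [if_pos hσg, ← hc1] at this
    exact absurd this (by decide)
  have : Nonempty (WeakCreature H D) := ⟨p.cr r⟩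
  choose! σ hσ hσpos hσn using hbig
  obtain ⟨q, hpq, hqS⟩ := exists_prune (p := p) (S := {ρ ∈ S | ProperPrefix ν₀ ρ})
    (fun ρ hρ => hρ.1.1) ⟨hν, hlt⟩ σ hσ hσpos hσn
  obtain ⟨q₁, hqq₁, hq₁⟩ := hτ q
  obtain ⟨ρ, hρ, hρl⟩ := q₁.exists_isLarge_restr M
  exact (hqS (T_subset hqq₁ hρ)).1.2 ⟨q₁.restr ρ hρ, le_trans hpq (le_trans hqq₁ (q₁.le_restr hρ)),
    q₁.isRoot_restr hρ, .of_decides (decides_mono (q₁.le_restr hρ) hq₁), hρl p⟩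

theorem exists_LEn_fronts (he : e = 0 ∧ C.IsTOmittory ∨ e = 1 ∧ C.IsBig 2) (p : QTree C e) (n : ℕ)
    (τ : ℕ → PName (QTree C e)) (hτ : ∀ k, IsOrdinalName (τ k)) :
    ∃ (q : QTree C e) (F : ℕ → Set (List α)), (∀ k, IsFront q.T (F k)) ∧
      LEn n p q ∧ q.DecidesAlong τ F := by
  have he' : e = 0 ∨ e = 1 := he.imp And.left And.left
  have h𝓑 := isTestFamily_branchTests (C := C) he'
  obtain ⟨q, hpq, hq⟩ := exists_LEn_fusion h𝓑 p n
    (fun m B hB => p.firstNodes_meets_branchTests he' m hB)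
    (fun k => {p | DecidesOnBranches p (τ k)}) fun M k p _ B hB => by
      obtain ⟨μ, hμ⟩ := h𝓑.nonempty p B hB
      have hμp := h𝓑.subset p B hB hμ
      obtain ⟨q, hle, hr, hd, hl⟩ : ∃ q, p.restr μ hμp ≤ q ∧ IsRoot q.T μ ∧
          DecidesOnBranches q (τ k) ∧ IsLarge M (p.restr μ hμp) q := by
        have hr := p.isRoot_restr hμp
        rcases he with ⟨rfl, hC⟩ | ⟨rfl, hC⟩
        · exact exists_decidesOnBranches_of_isTOmittory hC _ (hτ k) M hr
        · exact exists_decidesOnBranches_of_isBig hC _ (hτ k) M hr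
      exact ⟨μ, hμ, q, hd, hr, le_trans (p.le_restr hμp) hle, hl.of_restr hle⟩
  -- Fusion gives decisions along branches only; since a test is an infinite part of one branch, one
  -- of its later nodes decides outright.
  obtain ⟨F, hF, h⟩ := exists_decidesAlong h𝓑 q τ fun k B hB => by
    obtain ⟨μ, hμ, hμq, p', hp', hle⟩ := hq k B hB
    obtain ⟨hBq, x, hx, hinf⟩ := hB
    obtain ⟨i, rfl⟩ := hx μ hμ
    obtain ⟨m, hm⟩ := DecidesOnBranches.exists_of_le hp'
      (fun m => (hinf m).imp fun j hj => ⟨hj.1, hBq hj.2⟩) hμq hle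
    obtain ⟨j, hj, hjB⟩ := hinf m
    exact ⟨_, hjB, hBq hjB, hm j hj.le (hBq hjB)⟩
  refine ⟨q, F, fun k => ⟨(hF k).1, (hF k).2.1, fun x hx => ?_, fun η hη => ?_⟩, hpq, h⟩
  -- All nodes on the branch `x` form a test, and meeting it is the front property at `x`.
  · obtain ⟨ν, hν, μ, ⟨-, i, rfl⟩, hle⟩ := (hF k).2.2 {ν ∈ q.T | ∃ k, ν = initSeg x k}
      ⟨fun _ h => h.1, x, fun _ h => h.2, fun m => (hx m).imp fun i hi => ⟨hi.1, hi.2, i, rfl⟩⟩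
    exact ⟨ν.length, eq_initSeg_of_isPrefix hle ▸ hν⟩
  · rw [q.max_empty] at hη
    exact hη.elim

end QTree

end TreeCreature

/-! ### Properness -/

namespace TreeCreature

open Forcing

variable {α D : Type u} {H : ℕ → Set α} {C : TreeCreatingPair H D} {e : Fin 4}

/-- The countable sets closed under countably many partial binary operations form a club. -/
theorem isClubCountable_closed {X : Type u} {ι : Type*} [Countable ι]
    (F : ι → X → X → X) :
    IsClubCountable {N : Set X | N.Countable ∧ ∀ i, ∀ x ∈ N, ∀ y ∈ N, F i x y ∈ N} where
  countable := fun N hN => hN.1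
  unbounded := fun s hs => by
    let g : ℕ → Set X := fun n => Nat.rec s (fun _ N => N ∪ ⋃ i, Set.image2 (F i) N N) n
    have hg : ∀ n, (g n).Countable := fun n => by
      induction n with
      | zero => exact hs
      | succ n ih => exact ih.union (Set.countable_iUnion fun i => ih.image2 ih _)
    have hmono : Monotone g := monotone_nat_of_le_succ fun n => Set.subset_union_left
    refine ⟨⋃ n, g n, ⟨Set.countable_iUnion hg, fun i x hx y hy => ?_⟩, Set.subset_iUnion g 0⟩
    obtain ⟨m, hm⟩ := Set.mem_iUnion.1 hx
    obtain ⟨n, hn⟩ := Set.mem_iUnion.1 hy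
    exact Set.mem_iUnion.2 ⟨max m n + 1, Or.inr (Set.mem_iUnion.2 ⟨i, x,
      hmono (le_max_left m n) hm, y, hmono (le_max_right m n) hn, rfl⟩)⟩
  closed := fun f hf hN => by
    refine ⟨Set.countable_iUnion fun n => (hN n).1, fun i x hx y hy => ?_⟩
    obtain ⟨m, hm⟩ := Set.mem_iUnion.1 hx
    obtain ⟨n, hn⟩ := Set.mem_iUnion.1 hy
    exact Set.mem_iUnion.2 ⟨max m n, (hN _).2 i x (hf (le_max_left m n) hm) y
      (hf (le_max_right m n) hn)⟩

theorem countable_seqs (hH : (⋃ i, H i).Countable) : (Seqs H).Countable := by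
  have : Countable (⋃ i, H i : Set α) := hH
  refine (Set.countable_range fun l : List (⋃ i, H i : Set α) => l.map Subtype.val).mono ?_
  intro η hη
  have hmem : ∀ a ∈ η, a ∈ ⋃ i, H i := by
    intro a ha
    obtain ⟨i, hi, rfl⟩ := List.getElem_of_mem ha
    exact Set.mem_iUnion.2 ⟨i, hη i hi⟩
  exact ⟨η.attach.map fun a => ⟨a.1, hmem a.1 a.2⟩, by simp [Function.comp_def]⟩

namespace QTree

/-- A test `r.T` need not belong to `N`, but a suitable root `μ` found in it is one of countably
many sequences. Closure of `N` under choice functions indexed by `μ` replaces the condition found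
outside by one in `N` with the same root. -/
theorem isProper (hH : (⋃ i, H i).Countable) : IsProper (QTree C e) := by
  classical
  intro X i hi
  have hcount : Countable (Seqs H) := countable_seqs hH
  let R : (QTree C e) → Set (QTree C e) → List α → ℕ → QTree C e × QTree C e → Prop :=
    fun p 𝒟 μ k d => d.1 ∈ 𝒟 ∧ p ≤ d.2 ∧ d.1 ≤ d.2 ∧ IsRoot d.2.T μ ∧ IsLarge (k : ℝ) p d.2
  -- The Boolean selects which component of the chosen pair is returned; the default value `x` keeps
  -- closure harmless when there is no pair to choose.
  let F : Bool × ℕ × Seqs H → X → X → X := fun j x y =>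
    if h : ∃ d p 𝒟, x = i (Sum.inl p) ∧ y = i (Sum.inr 𝒟) ∧ R p 𝒟 j.2.2 j.2.1 d then
      i (Sum.inl (if j.1 then h.choose.1 else h.choose.2)) else x
  have hF : ∀ N : Set X, (∀ j, ∀ x ∈ N, ∀ y ∈ N, F j x y ∈ N) → ∀ p 𝒟 μ k d,
      i (Sum.inl p) ∈ N → i (Sum.inr 𝒟) ∈ N → R p 𝒟 μ k d →
      ∃ d, R p 𝒟 μ k d ∧ i (Sum.inl d.1) ∈ N ∧ i (Sum.inl d.2) ∈ N := by
    intro N hN p 𝒟 μ k d hp h𝒟 hd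
    have hμ : μ ∈ Seqs H := d.2.seqs hd.2.2.2.1.1
    have h : ∃ d p' 𝒟', i (Sum.inl p) = i (Sum.inl p') ∧ i (Sum.inr 𝒟) = i (Sum.inr 𝒟') ∧
      R p' 𝒟' μ k d := ⟨d, p, 𝒟, rfl, rfl, hd⟩
    have h1 := hN (true, k, ⟨μ, hμ⟩) _ hp _ h𝒟
    have h2 := hN (false, k, ⟨μ, hμ⟩) _ hp _ h𝒟
    simp only [F, dif_pos h, if_true] at h1
    simp only [F, dif_pos h, Bool.false_eq_true, if_false] at h2
    obtain ⟨p', 𝒟', hp', h𝒟', hR⟩ := h.choose_spec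
    obtain rfl := Sum.inl_injective (hi hp')
    obtain rfl := Sum.inr_injective (hi h𝒟')
    exact ⟨_, hR, h1, h2⟩
  refine ⟨_, isClubCountable_closed F, ?_⟩
  rintro N ⟨hNc, hN⟩ p hp
  by_cases hne : {𝒟 : Set (QTree C e) | IsDense 𝒟 ∧ i (Sum.inr 𝒟) ∈ N}.Nonempty
  swap
  · exact ⟨p, le_refl p, fun 𝒟 h𝒟 h𝒟N => (hne ⟨𝒟, h𝒟, h𝒟N⟩).elim⟩
  have hc : {𝒟 : Set (QTree C e) | IsDense 𝒟 ∧ i (Sum.inr 𝒟) ∈ N}.Countable :=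
    (hNc.preimage (hi.comp Sum.inr_injective)).mono fun 𝒟 h => h.2
  obtain ⟨𝒟, h𝒟⟩ := hc.exists_eq_range hne
  have h𝒟k : ∀ k, IsDense (𝒟 k) ∧ i (Sum.inr (𝒟 k)) ∈ N := fun k =>
    (h𝒟 ▸ Set.mem_range_self k : 𝒟 k ∈ {𝒟 | IsDense 𝒟 ∧ i (Sum.inr 𝒟) ∈ N})
  obtain ⟨r, hr⟩ := p.quasi
  let 𝒮 : ℕ → Set (QTree C e) := fun k =>
    {p | i (Sum.inl p) ∈ N ∧ ∀ j, k = j + 1 → ∃ d ∈ 𝒟 j, i (Sum.inl d) ∈ N ∧ d ≤ p}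
  have hp𝒮 : p ∈ 𝒮 0 := ⟨hp, fun j hj => by simp at hj⟩
  obtain ⟨q, hpq, -, -, hq⟩ := exists_fusion isTestFamily_thickTests (n := 0) (p := p) (A := {r})
    (𝒮 := 𝒮)
    (by
      rintro k p' ⟨hp', -⟩ _ ⟨r, hr, rfl⟩
      obtain ⟨d, hd, hrd⟩ := (h𝒟k k).1 r
      obtain ⟨μ, hμ, hl⟩ := d.exists_isLarge_restr k
      obtain ⟨⟨d₁, d₂⟩, ⟨h1, h2, h3, h4, h5⟩, hN1, hN2⟩ := hF N hN p' (𝒟 k) μ k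
        (d, d.restr μ hμ) hp' (h𝒟k k).2 ⟨hd, le_trans hr (le_trans hrd (d.le_restr hμ)),
          d.le_restr hμ, d.isRoot_restr hμ, hl p'⟩
      refine ⟨μ, T_subset hrd hμ, d₂, ⟨hN2, ?_⟩, h4, h2, by simpa using h5⟩
      rintro _ ⟨⟩
      exact ⟨d₁, h1, hN1, h3⟩)
    (isFusionState_root isTestFamily_thickTests hp𝒮 hr)
  refine ⟨q, hpq, fun 𝒜 h𝒜 h𝒜N r hqr => ?_⟩
  have h𝒜' : 𝒜 ∈ {𝒟 : Set (QTree C e) | IsDense 𝒟 ∧ i (Sum.inr 𝒟) ∈ N} := ⟨h𝒜, h𝒜N⟩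
  rw [h𝒟] at h𝒜'
  obtain ⟨k, rfl⟩ := h𝒜'
  obtain ⟨μ, hμ, hμq, p', ⟨-, hp'⟩, hle⟩ := hq (k + 1) r.T ⟨r, hqr, rfl⟩
  obtain ⟨d, hd, hdN, hdp⟩ := hp' k rfl
  -- The cone of `r` at `μ` is stronger than `r` and than `p'`, hence than the element `d` of the
  -- dense set in `N`.
  exact ⟨d, hd, hdN, r.restr μ hμ, le_trans hdp (le_trans hle
    (restr_le_restr hqr hμq hμ List.prefix_rfl)), r.le_restr hμ⟩

end QTree

end TreeCreature

theorem mainTheorem11 {α D : Type u} (H : ℕ → Set α) (C : TreeCreatingPair H D) :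
    -- properness
    (∀ e : Fin 4, (e = 2 → C.IsBounded) → (⋃ i, H i).Countable → IsProper (QTree C e)) ∧
    -- names for ordinals are decided on thick antichains, for `e < 3`
    (∀ e : Fin 4, e < 3 → (e = 2 → C.IsBounded) →
      ∀ (p : QTree C e) (n : ℕ) (τ : ℕ → PName (QTree C e)), (∀ k, IsOrdinalName (τ k)) →
        ∃ (q : QTree C e) (A : ℕ → Set (List α)), (∀ k, q.IsThickAntichain (A k)) ∧
          QTree.LEn n p q ∧ q.DecidesAlong τ A) ∧
    -- and for `e = 3`
    (∀ (p : QTree C 3) (τ : ℕ → PName (QTree C 3)), (∀ k, IsOrdinalName (τ k)) →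
        ∃ (q : QTree C 3) (A : ℕ → Set (List α)), (∀ k, q.IsThickAntichain (A k)) ∧
          p ≤ q ∧ q.DecidesAlong τ A) ∧
    -- names for ordinals are decided on fronts
    (∀ e : Fin 4, (e = 0 ∧ C.IsTOmittory ∨ e = 1 ∧ C.IsBig 2) →
      ∀ (p : QTree C e) (n : ℕ) (τ : ℕ → PName (QTree C e)), (∀ k, IsOrdinalName (τ k)) →
        ∃ (q : QTree C e) (F : ℕ → Set (List α)), (∀ k, IsFront q.T (F k)) ∧
          QTree.LEn n p q ∧ q.DecidesAlong τ F) := by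
  refine ⟨fun e _ hH => QTree.isProper hH, fun e he hb p n τ hτ =>
    QTree.exists_LEn_thickAntichains he hb p n τ hτ, fun p τ hτ =>
    QTree.exists_le_thickAntichains p τ hτ, fun e he p n τ hτ =>
    QTree.exists_LEn_fronts he p n τ hτ⟩
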